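/- Let $k\ge 2$, $d\ge 1$, and let $\mathcal H=([n],E)$ be a simple $k$-uniform hypergraph. Let $\mathcal A=(a_{i_1\dots i_k})$ be its normalized adjacency hypermatrix, $a_{i_1\dots i_k}=\frac1{(k-1)!}$ if $\{i_1,\dots,i_k\}\in E$ and $0$ otherwise. Put $f_i(x)=\sum_{j_2,\dots,j_k} a_{i j_2\dots j_k}x_{j_2}\cdots x_{j_k}$, let $A=(A_{ij})$ be an $n\times n$ matrix of distinct variables, let $\hat f_i=f_i\left(\frac{\partial}{\partial A_{i1}},\dots,\frac{\partial}{\partial A_{in}}\right)$, and define the $d$-th generalized trace of $\mathcal H$ by $$\operatorname{Tr}_d(\mathcal H)=(k-1)^{n-1}\sum_{\substack{d_1+\dots+d_n=d\\ d_i\ge 0}}\left(\prod_{i=1}^n\frac{\hat f_i^{\,d_i}}{(d_i(k-1))!}\right)\operatorname{tr}\left(A^{d(k-1)}\right).$$ A Veblen hypergraph is a $k$-uniform multi-hypergraph (repeated edges allowed) in which every vertex degree, counted with multiplicity, is divisible by $k$. The flattening $\underline H$ of a multi-hypergraph $H$ is obtained by deleting duplicate edges, and $H$ is an infragraph of $\mathcal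 H$ if $\underline H\subseteq\mathcal H$. Let $\mathcal V_d(\mathcal H)$ be the set of isomorphism classes of connected Veblen infragraphs of $\mathcal H$ with $d$ edges (with multiplicity). A rooting of a multi-hypergraph $H$ with $m$ edges on a linearly ordered vertex set is a sequence $R=((e_1,v_1),\dots,(e_m,v_m))$ with $v_i\in e_i$, $v_1\le\dots\le v_m$ and $\{e_1,\dots,e_m\}=E(H)$ as multisets. Its digraph $D_R$ is the directed multigraph having, for each $i$, one arc from $v_i$ to each $w\in e_i\setminus\{v_i\}$, all arcs being distinguishable. $R$ is an Euler rooting if $D_R$ has an Euler tour. For an Eulerian digraph $D$ let $\tau_D$ be the number of spanning arborescences of $D$ with a specified root (it does not depend on the root), and for a connected Veblen hypergraph $H$ let $$C_H=\sum_{R\text{ Euler rooting of }H}\ \frac{\tau_{D_R}}{\prod_{v\in V(D_R)}\deg^-_{D_R}(v)},\qquad (\#H\subseteq\mathcal H)=\frac{|\operatorname{Aut}(\underline H)|}{|\operatorname{Aut}(H)|}\,\bigl|\{S\subseteq\mathcal H: S\cong\underline H\}\bigr|,$$ where automorphisms are vertex permutations preserving edge multiplicities; both depend only on the isomorphism class of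 $H$. Then $$\operatorname{Tr}_d(\mathcal H)=d\,(k-1)^n\sum_{H\in\mathcal V_d(\mathcal H)}C_H\,(\#H\subseteq\mathcal H).$$ -/

import Mathlib

noncomputable section

namespace VeblenTrace

/-- A (labeled) multi-hypergraph whose vertices lie in `{0, …, n-1}`: a vertex set together with a
multiset of edges, each edge being a set of vertices. -/
@[ext]
structure MultiHypergraph (n : ℕ) where
  verts : Finset (Fin n)
  edges : Multiset (Finset (Fin n))
  edge_subset : ∀ e ∈ edges, e ⊆ verts

/-- A simple `k`-uniform hypergraph with vertex set `{0, …, n-1}`. -/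
structure KGraph (n k : ℕ) where
  edges : Finset (Finset (Fin n))
  card_edge : ∀ e ∈ edges, e.card = k

/-- A simple `k`-graph regarded as a multi-hypergraph. -/
def KGraph.toMulti {n k : ℕ} (𝓗 : KGraph n k) : MultiHypergraph n where
  verts := Finset.univ
  edges := 𝓗.edges.val
  edge_subset := fun e _ => Finset.subset_univ e

namespace MultiHypergraph

variable {n : ℕ}

/-- The degree of a vertex: the number of edges containing it, with multiplicity. -/
def degree (H : MultiHypergraph n) (v : Fin n) : ℕ :=
  (H.edges.filter fun e => v ∈ e).card

/-- Veblen hypergraphs: `k`-uniform, and `k` divides every degree. -/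
def IsVeblen (k : ℕ) (H : MultiHypergraph n) : Prop :=
  (∀ e ∈ H.edges, e.card = k) ∧ ∀ v ∈ H.verts, k ∣ H.degree v

/-- Connectedness: nonempty, and any two vertices are joined by a chain of edges. -/
def Connected (H : MultiHypergraph n) : Prop :=
  H.verts.Nonempty ∧ ∀ u ∈ H.verts, ∀ v ∈ H.verts,
    Relation.ReflTransGen (fun a b => ∃ e ∈ H.edges, a ∈ e ∧ b ∈ e) u v

/-- The flattening: duplicate edges are removed. -/
def flatten (H : MultiHypergraph n) : MultiHypergraph n where
  verts := H.verts
  edges := H.edges.dedup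
  edge_subset := fun e he => H.edge_subset e (Multiset.mem_dedup.mp he)

/-- `S` is a sub-hypergraph of `G`. -/
def IsSub (S G : MultiHypergraph n) : Prop :=
  S.verts ⊆ G.verts ∧ S.edges ≤ G.edges

/-- `H` is an infragraph of `G`: the flattening of `H` is a sub-hypergraph of `G`. -/
def IsInfragraph (H G : MultiHypergraph n) : Prop :=
  H.flatten.IsSub G

/-- The image of a set of vertices of `H` under a bijection of vertex sets. -/
def mapEdge {H G : MultiHypergraph n} (φ : H.verts ≃ G.verts) (e : Finset (Fin n)) :
    Finset (Fin n) :=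
  (e.subtype (· ∈ H.verts)).image fun v => (φ v : Fin n)

/-- Isomorphisms: bijections of the vertex sets carrying the multiset of edges of `H` to that
of `G`. -/
def Iso (H G : MultiHypergraph n) : Type :=
  {φ : H.verts ≃ G.verts // H.edges.map (mapEdge φ) = G.edges}

/-- Automorphisms (as vertex permutations preserving edge multiplicities). -/
abbrev Aut (H : MultiHypergraph n) : Type := Iso H H

theorem mapEdge_refl {H : MultiHypergraph n} {e : Finset (Fin n)} (he : e ⊆ H.verts) :
    mapEdge (Equiv.refl H.verts) e = e := by
  ext w
  simp only [mapEdge, Finset.mem_image, Finset.mem_subtype, Equiv.refl_apply]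
  exact ⟨by rintro ⟨v, hv, rfl⟩; exact hv, fun hw => ⟨⟨w, he hw⟩, hw, rfl⟩⟩

theorem mapEdge_trans {H G K : MultiHypergraph n} (φ : H.verts ≃ G.verts)
    (ψ : G.verts ≃ K.verts) (e : Finset (Fin n)) :
    mapEdge ψ (mapEdge φ e) = mapEdge (φ.trans ψ) e := by
  ext w
  simp only [mapEdge, Finset.mem_image, Finset.mem_subtype, Equiv.trans_apply]
  constructor
  · rintro ⟨v, ⟨u, hu, huv⟩, rfl⟩
    exact ⟨u, hu, by rw [Subtype.ext huv]⟩
  · rintro ⟨u, hu, rfl⟩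
    exact ⟨φ u, ⟨u, hu, rfl⟩, rfl⟩

theorem map_mapEdge_refl (H : MultiHypergraph n) :
    H.edges.map (mapEdge (Equiv.refl H.verts)) = H.edges := by
  conv_rhs => rw [← Multiset.map_id H.edges]
  exact Multiset.map_congr rfl fun e he => mapEdge_refl (H.edge_subset e he)

theorem Iso.equivalence : Equivalence fun H G : MultiHypergraph n => Nonempty (Iso H G) where
  refl H := ⟨⟨Equiv.refl _, map_mapEdge_refl H⟩⟩
  symm := by
    rintro H G ⟨φ, hφ⟩
    refine ⟨⟨φ.symm, ?_⟩⟩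
    rw [← hφ, Multiset.map_map]
    conv_rhs => rw [← map_mapEdge_refl H]
    refine Multiset.map_congr rfl fun e _ => ?_
    rw [Function.comp_apply, mapEdge_trans, Equiv.self_trans_symm]
  trans := by
    rintro H G K ⟨φ, hφ⟩ ⟨ψ, hψ⟩
    refine ⟨⟨φ.trans ψ, ?_⟩⟩
    rw [← hψ, ← hφ, Multiset.map_map]
    exact Multiset.map_congr rfl fun e _ => (mapEdge_trans φ ψ e).symm

/-- `(#H ⊆ G)` for a connected `H`:
`|Aut (flattening of H)| / |Aut H| * |{S ⊆ G : S ≅ flattening of H}|`. -/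
def count (H G : MultiHypergraph n) : ℚ :=
  (Nat.card H.flatten.Aut : ℚ) / (Nat.card H.Aut : ℚ) *
    (Nat.card {S : MultiHypergraph n // S.IsSub G ∧ Nonempty (Iso S H.flatten)} : ℚ)

end MultiHypergraph

/-- A finite directed multigraph with distinguishable arcs; isolated vertices are ignored. -/
structure MultiDigraph (n : ℕ) where
  Arc : Type
  [fintypeArc : Fintype Arc]
  src : Arc → Fin n
  tgt : Arc → Fin n

attribute [instance] MultiDigraph.fintypeArc

namespace MultiDigraph

variable {n : ℕ}

/-- The vertices: all endpoints of arcs. -/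
def verts (D : MultiDigraph n) : Finset (Fin n) :=
  Finset.univ.image D.src ∪ Finset.univ.image D.tgt

/-- The in-degree. -/
def inDeg (D : MultiDigraph n) (v : Fin n) : ℕ :=
  (Finset.univ.filter fun a => D.tgt a = v).card

/-- An Euler tour: an enumeration of all arcs, each exactly once, in which every arc ends where the
cyclically next one starts. -/
def IsEulerTour (D : MultiDigraph n) (t : Fin (Fintype.card D.Arc) ≃ D.Arc) : Prop :=
  ∀ i, D.tgt (t i) = D.src (t (finRotate _ i))

/-- A digraph is Eulerian if it has an Euler tour. -/
def IsEulerian (D : MultiDigraph n) : Prop :=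
  ∃ t, D.IsEulerTour t

/-- `T` is the arc set of a spanning arborescence with root `r`: no arc of `T` enters `r`, exactly
one arc of `T` enters any other vertex, and every vertex is reachable from `r` along `T`. -/
structure IsArborescence (D : MultiDigraph n) (r : Fin n) (T : Finset D.Arc) : Prop where
  root : ∀ a ∈ T, D.tgt a ≠ r
  unique : ∀ v ∈ D.verts, v ≠ r → ∃! a, a ∈ T ∧ D.tgt a = v
  reach : ∀ v ∈ D.verts,
    Relation.ReflTransGen (fun u w => ∃ a ∈ T, D.src a = u ∧ D.tgt a = w) r v

/-- The number of spanning arborescences of `D` with specified root `r`. -/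
def numArborescences (D : MultiDigraph n) (r : Fin n) : ℕ :=
  Nat.card {T : Finset D.Arc // D.IsArborescence r T}

end MultiDigraph

/-- A sequence of `m` pairs `(e, v)`; the pair `(e, v)` stands for the star of `e` rooted at `v`. -/
abbrev StarSeq (n m : ℕ) : Type := Fin m → Finset (Fin n) × Fin n

namespace StarSeq

variable {n m : ℕ}

/-- `R` is a rooting of `H`: its edges are the edges of `H` with multiplicity, each root lies in its
edge, and the roots are weakly increasing. -/
structure IsRooting (R : StarSeq n m) (H : MultiHypergraph n) : Prop where
  edges_eq : (Finset.univ : Finset (Fin m)).val.map (fun i => (R i).1) = H.edges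
  root_mem : ∀ i, (R i).2 ∈ (R i).1
  mono : Monotone fun i => (R i).2

/-- The rooted multi-digraph of `R`: for each `i`, with `R i = (e, v)`, one arc from `v` to every
`w ∈ e`, `w ≠ v`. -/
def digraph (R : StarSeq n m) : MultiDigraph n where
  Arc := {p : Fin m × Fin n // p.2 ∈ (R p.1).1 ∧ p.2 ≠ (R p.1).2}
  src := fun p => (R p.1.1).2
  tgt := fun p => p.1.2

end StarSeq

open scoped Classical in
/-- The associated coefficient of a connected Veblen hypergraph `H`: the sum over all Euler rootings
`R` of `H`, with digraph `D`, of `τ_D / ∏ v ∈ V(D), deg⁻ v`, where `τ_D` counts the arborescences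
of `D` with specified root `r`. -/
def assocCoeff {n : ℕ} (H : MultiHypergraph n) (r : Fin n) : ℚ :=
  ∑ R : StarSeq n H.edges.card with R.IsRooting H ∧ R.digraph.IsEulerian,
    (R.digraph.numArborescences r : ℚ) / ∏ v ∈ R.digraph.verts, (R.digraph.inDeg v : ℚ)

/-- The connected Veblen infragraphs of `𝓗` with `d` edges. -/
def ConnVeblenInfragraph {n k : ℕ} (𝓗 : KGraph n k) (d : ℕ) : Type :=
  {H : MultiHypergraph n //
    H.IsInfragraph 𝓗.toMulti ∧ H.IsVeblen k ∧ H.Connected ∧ H.edges.card = d}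

instance {n k : ℕ} (𝓗 : KGraph n k) (d : ℕ) : Finite (ConnVeblenInfragraph 𝓗 d) := by
  let f : ConnVeblenInfragraph 𝓗 d → Finset (Fin n) × Sym (Finset (Fin n)) d :=
    fun H => (H.1.verts, ⟨H.1.edges, H.2.2.2.2⟩)
  refine Finite.of_injective f fun H G h => ?_
  have h1 : H.1.verts = G.1.verts := congrArg Prod.fst h
  have h2 : H.1.edges = G.1.edges := congrArg (fun p => (p.2 : Multiset (Finset (Fin n)))) h
  exact Subtype.ext (MultiHypergraph.ext h1 h2)

/-- Isomorphism of connected Veblen infragraphs. -/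
instance isoSetoid {n k : ℕ} (𝓗 : KGraph n k) (d : ℕ) : Setoid (ConnVeblenInfragraph 𝓗 d) where
  r H G := Nonempty (MultiHypergraph.Iso H.1 G.1)
  iseqv :=
    { refl := fun H => MultiHypergraph.Iso.equivalence.refl H.1
      symm := fun h => MultiHypergraph.Iso.equivalence.symm h
      trans := fun h h' => MultiHypergraph.Iso.equivalence.trans h h' }

/-- The set of isomorphism classes of connected Veblen infragraphs of `𝓗` with `d` edges. -/
def VeblenClasses {n k : ℕ} (𝓗 : KGraph n k) (d : ℕ) : Type :=
  Quotient (isoSetoid 𝓗 d)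

instance {n k : ℕ} (𝓗 : KGraph n k) (d : ℕ) : Fintype (VeblenClasses 𝓗 d) :=
  haveI : Finite (VeblenClasses 𝓗 d) :=
    inferInstanceAs (Finite (Quotient (isoSetoid 𝓗 d)))
  Fintype.ofFinite _

/-- Hypermatrices of order `k` and dimension `n`; the first index is written separately from the
other `k - 1`. -/
abbrev Hypermatrix (n k : ℕ) : Type := Fin n → (Fin (k - 1) → Fin n) → ℚ

/-- The normalized adjacency hypermatrix. -/
def KGraph.adjacency {n k : ℕ} (𝓗 : KGraph n k) : Hypermatrix n k :=
  fun i j => if insert i (Finset.univ.image j) ∈ 𝓗.edges then 1 / ((k - 1).factorial : ℚ) else 0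

/-- Polynomials in the entries `A i j` of a generic `n × n` matrix. -/
abbrev EntryPoly (n : ℕ) : Type := MvPolynomial (Fin n × Fin n) ℚ

/-- The operator `f_i(∂/∂A_{i1}, …, ∂/∂A_{in})`, where
`f_i = ∑ a_{i j_2 … j_k} x_{j_2} ⋯ x_{j_k}` is the `i`-th coordinate of `𝒜 x^{⊗ (k-1)}`. -/
def Hypermatrix.op {n k : ℕ} (𝒜 : Hypermatrix n k) (i : Fin n) : Module.End ℚ (EntryPoly n) :=
  ∑ j : Fin (k - 1) → Fin n,
    𝒜 i j • (List.ofFn fun t => ((MvPolynomial.pderiv (i, j t)).toLinearMap :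
      Module.End ℚ (EntryPoly n))).prod

/-- The `d`-th generalized trace
`(k-1)^(n-1) ∑_{d_1+⋯+d_n=d} (∏_i f̂_i^{d_i} / (d_i (k-1))!) tr(A^{d(k-1)})`.
The operators have total order `d (k-1)`, so this is a constant polynomial. -/
def Hypermatrix.genTrace {n k : ℕ} (𝒜 : Hypermatrix n k) (d : ℕ) : EntryPoly n :=
  ((k : ℚ) - 1) ^ (n - 1) • ∑ δ ∈ Finset.piAntidiag (Finset.univ : Finset (Fin n)) d,
    (List.ofFn fun i => (1 / ((δ i * (k - 1)).factorial : ℚ)) • 𝒜.op i ^ δ i).prod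
      (Matrix.trace (Matrix.mvPolynomialX (Fin n) (Fin n) ℚ ^ (d * (k - 1))))

end VeblenTrace

end

/-! Expand the product of operators. The factor `1 / (k-1)!` in the adjacency hypermatrix cancels
the orderings of the non-root vertices of an edge, so `f̂_i` is the sum, over the edges at `i`, of
the product of the derivatives along the arcs of the star rooted at `i`. The composition `d_1 + ⋯ +
d_n = d` records how often each root occurs, that is, a weakly increasing root sequence. Hence the
trace is `(k-1)^(n-1)` times the sum of `R.weight k` over sorted sequences `R` of `d` stars in `𝓗`
(`genTrace_eq`).

The weight is computed by a BEST-type count. Differentiating `tr (A ^ N)` along the first of `N`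
arcs gives `N` times an entry of `A ^ (N - 1)`. The other derivatives then count the trails using
every remaining arc once (`iterDeriv_genericMatrix_pow`), and `trails_eq` evaluates this number as
`τ_D ∏ (deg⁻ v - 1)!`. Non-Eulerian digraphs contribute zero. In an Eulerian one, `deg⁻ v` is the
out-degree `rootCount v * (k - 1)`, so division by the factorials in the trace leaves `N τ_D / ∏
deg⁻ v` with `N = d (k-1)`; this supplies the factor `d` and the last factor `k - 1`.

It remains to regroup. The edges of an Euler rooting form a connected Veblen hypergraph, because the
degree of `v` is `deg⁻ v + rootCount v = k * rootCount v`. So the sum runs over labeled connected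
Veblen infragraphs and their rootings (`sum_weight_eq`). The rooting sum is invariant under
isomorphism, and `(#H ⊆ 𝓗)` is the number of labeled infragraphs isomorphic to `H` (`count_eq`). -/

noncomputable section

namespace VeblenTrace

/-! ### Counting Euler trails by spanning trees. -/

section Trails

set_option linter.unusedSectionVars false

variable {V α : Type*} [DecidableEq V] [DecidableEq α]

/-- The number of arcs `a ∈ S` with `p a = v`. -/
def arcDeg (p : α → V) (S : Finset α) (v : V) : ℕ := {a ∈ S | p a = v}.card

/-- The number of ways to use up `m` arcs of `S` by walking from `u` to `r`, an arc `a` leading from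
`p a` to `q a`. -/
def trails (p q : α → V) (r : V) : ℕ → Finset α → V → ℕ
  | 0, _, u => if u = r then 1 else 0
  | m + 1, S, u => ∑ a ∈ S with p a = u, trails p q r m (S.erase a) (q a)

/-- `T ⊆ S` is a spanning tree with root `r`, each arc `a` of which leads from `q a` to `p a`. -/
structure IsSpanningTree (p q : α → V) (r : V) (S T : Finset α) : Prop where
  subset : T ⊆ S
  root : ∀ a ∈ T, p a ≠ r
  unique : ∀ v, v ≠ r → v ∈ S.image p → ∃! a, a ∈ T ∧ p a = v
  reach : ∀ v, v ≠ r → v ∈ S.image p →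
    Relation.ReflTransGen (fun u w => ∃ a ∈ T, q a = u ∧ p a = w) r v

open scoped Classical in
/-- The finite set of spanning trees. -/
def spanningTrees (p q : α → V) (r : V) (S : Finset α) : Finset (Finset α) :=
  {T ∈ S.powerset | IsSpanningTree p q r S T}

variable {p q : α → V} {r : V}

theorem mem_spanningTrees {S T : Finset α} :
    T ∈ spanningTrees p q r S ↔ IsSpanningTree p q r S T := by
  classical
  simp only [spanningTrees, Finset.mem_filter, Finset.mem_powerset]
  exact ⟨fun h => h.2, fun h => ⟨h.subset, h⟩⟩

theorem arcDeg_erase {S : Finset α} {a : α} (ha : a ∈ S) (v : V) :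
    arcDeg p (S.erase a) v + (if v = p a then 1 else 0) = arcDeg p S v := by
  unfold arcDeg
  rw [Finset.filter_erase]
  split_ifs with h
  · rw [Finset.card_erase_add_one]
    simp [ha, h]
  · rw [Finset.erase_eq_of_notMem]
    · rfl
    · simp only [Finset.mem_filter, not_and]
      exact fun _ h' => h h'.symm

theorem arcDeg_pos {S : Finset α} {v : V} : 0 < arcDeg p S v ↔ ∃ a ∈ S, p a = v := by
  simp [arcDeg, Finset.card_pos, Finset.Nonempty]

theorem arcDeg_pos_iff_mem_image {S : Finset α} {v : V} :
    0 < arcDeg p S v ↔ v ∈ S.image p := by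
  simp [arcDeg_pos]

theorem spanningTrees_erase_root {S : Finset α} {a : α} (ha : p a = r) :
    spanningTrees p q r (S.erase a) = spanningTrees p q r S := by
  have himg : ∀ v, v ≠ r → (v ∈ (S.erase a).image p ↔ v ∈ S.image p) := by
    intro v hv
    simp only [Finset.mem_image, Finset.mem_erase]
    constructor
    · rintro ⟨b, ⟨_, hb⟩, rfl⟩; exact ⟨b, hb, rfl⟩
    · rintro ⟨b, hb, rfl⟩; exact ⟨b, ⟨by rintro rfl; exact hv ha, hb⟩, rfl⟩
  ext T
  rw [mem_spanningTrees, mem_spanningTrees]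
  constructor
  · intro h
    exact ⟨h.subset.trans (Finset.erase_subset _ _), h.root,
      fun v hv hv' => h.unique v hv ((himg v hv).2 hv'),
      fun v hv hv' => h.reach v hv ((himg v hv).2 hv')⟩
  · intro h
    refine ⟨fun b hb => Finset.mem_erase.2 ⟨?_, h.subset hb⟩, h.root,
      fun v hv hv' => h.unique v hv ((himg v hv).1 hv'),
      fun v hv hv' => h.reach v hv ((himg v hv).1 hv')⟩
    rintro rfl
    exact h.root _ hb ha

/-- Another arc remains at `p a`, so the deletion does not change the set of vertices to be spanned.
-/
theorem spanningTrees_erase {S : Finset α} {a : α} (ha : a ∈ S)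
    (h2 : 2 ≤ arcDeg p S (p a)) :
    spanningTrees p q r (S.erase a) = {T ∈ spanningTrees p q r S | a ∉ T} := by
  have himg : (S.erase a).image p = S.image p := by
    ext v
    rw [← arcDeg_pos_iff_mem_image, ← arcDeg_pos_iff_mem_image]
    have := arcDeg_erase (p := p) ha v
    split_ifs at this with h
    · subst h; omega
    · omega
  ext T
  rw [Finset.mem_filter, mem_spanningTrees, mem_spanningTrees]
  constructor
  · intro h
    refine ⟨⟨h.subset.trans (Finset.erase_subset _ _), h.root, ?_, ?_⟩,
      fun h' => (Finset.mem_erase.1 (h.subset h')).1 rfl⟩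
    · rw [← himg]; exact h.unique
    · rw [← himg]; exact h.reach
  · rintro ⟨h, haT⟩
    refine ⟨fun b hb => Finset.mem_erase.2 ⟨?_, h.subset hb⟩, h.root, ?_, ?_⟩
    · rintro rfl; exact haT hb
    · rw [himg]; exact h.unique
    · rw [himg]; exact h.reach

theorem card_filter_notMem_spanningTree {S T : Finset α} {u : V}
    (hT : IsSpanningTree p q r S T) (hu : u ≠ r) (hpos : 0 < arcDeg p S u) :
    {a ∈ S | p a = u ∧ a ∉ T}.card = arcDeg p S u - 1 := by
  obtain ⟨b, ⟨hbT, hbu⟩, hb⟩ := hT.unique u hu (arcDeg_pos_iff_mem_image.1 hpos)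
  have : {a ∈ S | p a = u ∧ a ∉ T} = {a ∈ S | p a = u}.erase b := by
    ext a
    simp only [Finset.mem_filter, Finset.mem_erase]
    constructor
    · rintro ⟨h1, h2, h3⟩
      exact ⟨by rintro rfl; exact h3 hbT, h1, h2⟩
    · rintro ⟨h1, h2, h3⟩
      exact ⟨h2, h3, fun h4 => h1 (hb a ⟨h4, h3⟩)⟩
  rw [this, Finset.card_erase_of_mem]
  · rfl
  · simp [hT.subset hbT, hbu]

theorem IsSpanningTree.insert_leaf {S T : Finset α} {a : α} (ha : a ∈ S) (har : p a ≠ r)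
    (hdeg : ∀ b ∈ S, p b = p a → b = a)
    (hq : q a = r ∨ q a ∈ (S.erase a).image p)
    (hT : IsSpanningTree p q r (S.erase a) T) :
    IsSpanningTree p q r S (insert a T) := by
  have hTS : ∀ b ∈ T, b ≠ a ∧ b ∈ S := fun b hb => Finset.mem_erase.1 (hT.subset hb)
  have himg : ∀ v, v ≠ p a → v ∈ S.image p → v ∈ (S.erase a).image p := by
    intro v hv hv'
    obtain ⟨b, hb, rfl⟩ := Finset.mem_image.1 hv'
    exact Finset.mem_image_of_mem _ (Finset.mem_erase.2 ⟨by rintro rfl; exact hv rfl, hb⟩)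
  have hmono : ∀ v, Relation.ReflTransGen (fun u w => ∃ b ∈ T, q b = u ∧ p b = w) r v →
      Relation.ReflTransGen (fun u w => ∃ b ∈ insert a T, q b = u ∧ p b = w) r v := by
    intro v hv
    refine Relation.ReflTransGen.mono (r := fun u w => ∃ b ∈ T, q b = u ∧ p b = w) ?_ _ _ hv
    rintro x y ⟨b, hb, h⟩
    exact ⟨b, Finset.mem_insert_of_mem hb, h⟩
  refine ⟨?_, ?_, ?_, ?_⟩
  · exact Finset.insert_subset ha fun b hb => (hTS b hb).2
  · intro b hb
    rcases Finset.mem_insert.1 hb with rfl | hb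
    · exact har
    · exact hT.root b hb
  · intro v hv hv'
    by_cases h : v = p a
    · subst h
      refine ⟨a, ⟨Finset.mem_insert_self _ _, rfl⟩, ?_⟩
      rintro b ⟨hb, hb'⟩
      rcases Finset.mem_insert.1 hb with rfl | hb
      · rfl
      · exact hdeg b (hTS b hb).2 hb'
    · obtain ⟨b, ⟨hb, hbv⟩, hbu⟩ := hT.unique v hv (himg v h hv')
      refine ⟨b, ⟨Finset.mem_insert_of_mem hb, hbv⟩, ?_⟩
      rintro c ⟨hc, hcv⟩
      rcases Finset.mem_insert.1 hc with rfl | hc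
      · exact absurd hcv.symm h
      · exact hbu c ⟨hc, hcv⟩
  · intro v hv hv'
    by_cases h : v = p a
    · subst h
      have h1 : Relation.ReflTransGen (fun u w => ∃ b ∈ insert a T, q b = u ∧ p b = w) r (q a) := by
        by_cases h0 : q a = r
        · rw [h0]
        · exact hmono _ (hT.reach _ h0 (hq.resolve_left h0))
      exact h1.tail ⟨a, Finset.mem_insert_self _ _, rfl, rfl⟩
    · exact hmono _ (hT.reach v hv (himg v h hv'))

theorem IsSpanningTree.erase_leaf {S T : Finset α} {a : α} (haS : a ∈ S) (har : p a ≠ r)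
    (hdeg : ∀ b ∈ S, p b = p a → b = a) (hq : ∀ b ∈ S, q b ≠ p a)
    (hT : IsSpanningTree p q r S T) :
    a ∈ T ∧ IsSpanningTree p q r (S.erase a) (T.erase a) := by
  have haT : a ∈ T := by
    obtain ⟨b, ⟨hb, hbv⟩, -⟩ := hT.unique (p a) har (Finset.mem_image_of_mem _ haS)
    rwa [← hdeg b (hT.subset hb) hbv]
  have hreach : ∀ v, Relation.ReflTransGen (fun u w => ∃ b ∈ T, q b = u ∧ p b = w) r v →
      v = p a ∨ Relation.ReflTransGen (fun u w => ∃ b ∈ T.erase a, q b = u ∧ p b = w) r v := by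
    intro v hv
    induction hv with
    | refl => exact Or.inr .refl
    | tail _ hstep ih =>
      obtain ⟨b, hb, rfl, rfl⟩ := hstep
      by_cases hba : b = a
      · exact Or.inl (by rw [hba])
      · right
        rcases ih with ih | ih
        · exact absurd ih (hq b (hT.subset hb))
        · exact ih.tail ⟨b, Finset.mem_erase.2 ⟨hba, hb⟩, rfl, rfl⟩
  have himg : ∀ v, v ∈ (S.erase a).image p → v ≠ p a ∧ v ∈ S.image p := by
    intro v hv
    obtain ⟨b, hb, rfl⟩ := Finset.mem_image.1 hv
    obtain ⟨hba, hb⟩ := Finset.mem_erase.1 hb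
    exact ⟨fun h => hba (hdeg b hb h), Finset.mem_image_of_mem _ hb⟩
  refine ⟨haT, ⟨Finset.erase_subset_erase _ hT.subset,
    fun b hb => hT.root b (Finset.mem_of_mem_erase hb), ?_, ?_⟩⟩
  · intro v hv hv'
    obtain ⟨h1, h2⟩ := himg v hv'
    obtain ⟨b, ⟨hb, hbv⟩, hbu⟩ := hT.unique v hv h2
    refine ⟨b, ⟨Finset.mem_erase.2 ⟨?_, hb⟩, hbv⟩,
      fun c hc => hbu c ⟨Finset.mem_of_mem_erase hc.1, hc.2⟩⟩
    rintro rfl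
    exact h1 hbv.symm
  · intro v hv hv'
    obtain ⟨h1, h2⟩ := himg v hv'
    exact (hreach v (hT.reach v hv h2)).resolve_left h1

/-- Here `p a` is a leaf in every tree: `a` is the only arc that can attach it, and no arc continues
from it. Adding and removing `a` are mutually inverse. -/
theorem card_spanningTrees_erase_leaf {S : Finset α} {a : α} (ha : a ∈ S) (har : p a ≠ r)
    (hdeg : ∀ b ∈ S, p b = p a → b = a) (hq : ∀ b ∈ S, q b ≠ p a)
    (hqa : q a = r ∨ q a ∈ (S.erase a).image p) :
    (spanningTrees p q r (S.erase a)).card = (spanningTrees p q r S).card := by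
  refine Finset.card_bij' (fun T _ => insert a T) (fun T _ => T.erase a) ?_ ?_ ?_ ?_
  · intro T hT
    exact mem_spanningTrees.2 ((mem_spanningTrees.1 hT).insert_leaf ha har hdeg hqa)
  · intro T hT
    exact mem_spanningTrees.2 ((mem_spanningTrees.1 hT).erase_leaf ha har hdeg hq).2
  · intro T hT
    refine Finset.erase_insert fun h => ?_
    exact (Finset.mem_erase.1 ((mem_spanningTrees.1 hT).subset h)).1 rfl
  · intro T hT
    exact Finset.insert_erase ((mem_spanningTrees.1 hT).erase_leaf ha har hdeg hq).1

theorem spanningTrees_eq_empty {S : Finset α} (hS : S.Nonempty) (hp : ∀ a ∈ S, p a ≠ r)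
    (hq : ∀ a ∈ S, q a ≠ r) : spanningTrees p q r S = ∅ := by
  refine Finset.eq_empty_of_forall_notMem fun T hT => ?_
  rw [mem_spanningTrees] at hT
  obtain ⟨a, ha⟩ := hS
  rcases (hT.reach (p a) (hp a ha) (Finset.mem_image_of_mem _ ha)).cases_head
    with h | ⟨_, ⟨b, hb, h, -⟩, -⟩
  · exact hp a ha h.symm
  · exact hq b (hT.subset hb) h

theorem spanningTrees_empty : (spanningTrees p q r ∅).card = 1 := by
  rw [Finset.card_eq_one]
  refine ⟨∅, ?_⟩
  ext T
  rw [mem_spanningTrees, Finset.mem_singleton]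
  constructor
  · exact fun h => Finset.subset_empty.1 h.subset
  · rintro rfl
    exact ⟨Finset.Subset.refl _, by simp, by simp, by simp⟩

/-- Induction on the number of arcs, deleting the first arc of the trail. The balance condition
`hbal` is the degree condition for a trail from `u` to `r`, and it passes to the remaining arcs.
Vertices without arcs contribute `(0 - 1)! = 1`. -/
theorem trails_eq [Fintype V] (m : ℕ) (S : Finset α) (u : V) (hS : S.card = m)
    (hbal : ∀ v, arcDeg p S v + (if v = r then 1 else 0) =
      arcDeg q S v + (if v = u then 1 else 0)) :
    trails p q r m S u = (spanningTrees p q r S).card *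
      ((arcDeg p S r).factorial * ∏ v ∈ Finset.univ.erase r, (arcDeg p S v - 1).factorial) := by
  induction m generalizing S u with
  | zero =>
    rw [Finset.card_eq_zero] at hS
    subst hS
    have := hbal u
    have hu : u = r := by
      by_contra h
      simp [arcDeg, h] at this
    simp [trails, hu, spanningTrees_empty, arcDeg]
  | succ m ih =>
    have hb : ∀ a ∈ S, p a = u → ∀ v, arcDeg p (S.erase a) v + (if v = r then 1 else 0) =
        arcDeg q (S.erase a) v + (if v = q a then 1 else 0) := by
      intro a ha hau v
      have h1 := arcDeg_erase (p := p) ha v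
      have h2 := arcDeg_erase (p := q) ha v
      have h3 := hbal v
      rw [hau] at h1
      omega
    have hstep : trails p q r (m + 1) S u = ∑ a ∈ S with p a = u,
        (spanningTrees p q r (S.erase a)).card * ((arcDeg p (S.erase a) r).factorial *
          ∏ v ∈ Finset.univ.erase r, (arcDeg p (S.erase a) v - 1).factorial) := by
      rw [trails]
      refine Finset.sum_congr rfl fun a ha => ?_
      obtain ⟨ha, hau⟩ := Finset.mem_filter.1 ha
      exact ih _ _ (by rw [Finset.card_erase_of_mem ha, hS]; rfl) (hb a ha hau)
    rw [hstep]
    by_cases hur : u = r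
    · subst hur
      -- At the root the walk is either stuck with arcs left over, in which case no tree can start
      -- at the root and both sides vanish, or it has `arcDeg p S u` choices, none of which affects
      -- the trees.
      rcases Nat.eq_zero_or_pos (arcDeg p S u) with h0 | hpos
      · have hp : ∀ a ∈ S, p a ≠ u := fun a ha h =>
          absurd (arcDeg_pos.2 ⟨a, ha, h⟩) (by omega)
        have hq : ∀ a ∈ S, q a ≠ u := fun a ha h => by
          have h1 : 0 < arcDeg q S u := arcDeg_pos.2 ⟨a, ha, h⟩
          have h2 := hbal u
          omega
        rw [spanningTrees_eq_empty (Finset.card_pos.1 (by omega)) hp hq,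
          Finset.sum_eq_zero]
        · simp
        · intro a ha
          obtain ⟨ha, hau⟩ := Finset.mem_filter.1 ha
          exact absurd hau (hp a ha)
      · have : ∀ a ∈ S.filter (fun a => p a = u),
            (spanningTrees p q u (S.erase a)).card * ((arcDeg p (S.erase a) u).factorial *
              ∏ v ∈ Finset.univ.erase u, (arcDeg p (S.erase a) v - 1).factorial) =
            (spanningTrees p q u S).card * ((arcDeg p S u - 1).factorial *
              ∏ v ∈ Finset.univ.erase u, (arcDeg p S v - 1).factorial) := by
          intro a ha
          obtain ⟨ha, hau⟩ := Finset.mem_filter.1 ha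
          rw [spanningTrees_erase_root hau]
          have h1 := arcDeg_erase (p := p) ha u
          rw [if_pos hau.symm] at h1
          rw [← h1, Nat.add_sub_cancel]
          congr 2
          refine Finset.prod_congr rfl fun v hv => ?_
          have h2 := arcDeg_erase (p := p) ha v
          rw [if_neg (by rw [hau]; exact Finset.ne_of_mem_erase hv)] at h2
          rw [← h2, Nat.add_zero]
        rw [Finset.sum_congr rfl this, Finset.sum_const, smul_eq_mul]
        change arcDeg p S u * _ = _
        rw [← Nat.mul_factorial_pred hpos.ne']
        ring
    · have hpos : 0 < arcDeg p S u := by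
        have := hbal u
        rw [if_neg hur, if_pos rfl] at this
        omega
      have hu_mem : u ∈ (Finset.univ : Finset V).erase r := by simp [hur]
      have hprod : ∀ a ∈ S.filter (fun a => p a = u),
          (arcDeg p (S.erase a) r).factorial *
            ∏ v ∈ Finset.univ.erase r, (arcDeg p (S.erase a) v - 1).factorial =
          (arcDeg p S u - 1 - 1).factorial * ((arcDeg p S r).factorial *
            ∏ v ∈ (Finset.univ.erase r).erase u, (arcDeg p S v - 1).factorial) := by
        intro a ha
        obtain ⟨ha, hau⟩ := Finset.mem_filter.1 ha
        have h0 : ∀ v, v ≠ u → arcDeg p (S.erase a) v = arcDeg p S v := fun v hv => by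
          have h2 := arcDeg_erase (p := p) ha v
          rw [if_neg (by rwa [hau])] at h2
          omega
        have h1 := arcDeg_erase (p := p) ha u
        rw [if_pos hau.symm] at h1
        rw [← Finset.mul_prod_erase _ _ hu_mem, h0 r (Ne.symm hur), ← h1, Nat.add_sub_cancel,
          Finset.prod_congr rfl fun v hv => by rw [h0 v (Finset.ne_of_mem_erase hv)]]
        ring
      rw [Finset.sum_congr rfl fun a ha => by rw [hprod a ha], ← Finset.sum_mul,
        ← Finset.mul_prod_erase _ _ hu_mem]
      rcases Nat.lt_or_ge 1 (arcDeg p S u) with h2 | h1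
      · have hsum : ∑ a ∈ S with p a = u, (spanningTrees p q r (S.erase a)).card =
            (spanningTrees p q r S).card * (arcDeg p S u - 1) := by
          have e1 : ∀ a ∈ S.filter (fun a => p a = u),
              (spanningTrees p q r (S.erase a)).card =
                ∑ T ∈ spanningTrees p q r S, if a ∉ T then 1 else 0 := by
            intro a ha
            obtain ⟨ha, hau⟩ := Finset.mem_filter.1 ha
            rw [spanningTrees_erase ha (by rw [hau]; omega), Finset.card_filter]
          rw [Finset.sum_congr rfl e1, Finset.sum_comm, ← smul_eq_mul, ← Finset.sum_const]
          refine Finset.sum_congr rfl fun T hT => ?_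
          rw [← card_filter_notMem_spanningTree (mem_spanningTrees.1 hT) hur hpos,
            ← Finset.card_filter, Finset.filter_filter]
        rw [hsum, ← Nat.mul_factorial_pred (n := arcDeg p S u - 1) (by omega)]
        ring
      · have hone : arcDeg p S u = 1 := by omega
        obtain ⟨a, ha⟩ := Finset.card_eq_one.1 hone
        have haS : a ∈ S ∧ p a = u := by
          have : a ∈ S.filter (fun a => p a = u) := by rw [ha]; simp
          simpa using this
        obtain ⟨haS, rfl⟩ := haS
        -- With a single arc left at `u`, balance says that the walk never returns to `u`, so this
        -- arc is a leaf of every tree. The factorials of `1 - 1 - 1` and `1 - 1` agree.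
        have hqdeg : arcDeg q S (p a) = 0 := by
          have := hbal (p a)
          rw [if_neg hur, if_pos rfl] at this
          omega
        rw [ha, Finset.sum_singleton, card_spanningTrees_erase_leaf haS hur, hone]
        · ring_nf
        · intro b hb hba
          have : b ∈ S.filter (fun b => p b = p a) := by simp [hb, hba]
          rw [ha] at this
          simpa using this
        · intro b hb hba
          have : 0 < arcDeg q S (p a) := arcDeg_pos.2 ⟨b, hb, hba⟩
          omega
        · by_cases h : q a = r
          · exact Or.inl h
          · right
            rw [← arcDeg_pos_iff_mem_image]
            have := hb a haS rfl (q a)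
            rw [if_neg h, if_pos rfl] at this
            omega

/-- `w` reads the walk backwards from `r` to `u`. With `p` the target and `q` the source, the arcs
are then traversed in their own direction. -/
theorem exists_walk_of_trails_ne_zero [Nonempty α] (m : ℕ) (S : Finset α) (u : V)
    (h : trails p q r m S u ≠ 0) :
    ∃ (f : ℕ → α) (w : ℕ → V), w 0 = r ∧ w m = u ∧
      (∀ i < m, f i ∈ S ∧ q (f i) = w i ∧ p (f i) = w (i + 1)) ∧
      ∀ i < m, ∀ j < m, f i = f j → i = j := by
  induction m generalizing S u with
  | zero =>
    have hu : u = r := by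
      by_contra h'
      simp [trails, h'] at h
    exact ⟨fun _ => Classical.arbitrary α, fun _ => r, rfl, hu.symm, by simp, by simp⟩
  | succ m ih =>
    rw [trails] at h
    obtain ⟨a, ha, hne⟩ := Finset.exists_ne_zero_of_sum_ne_zero h
    obtain ⟨haS, rfl⟩ := Finset.mem_filter.1 ha
    obtain ⟨f, w, hw0, hwm, hf, hinj⟩ := ih _ _ hne
    have hlt : ∀ i < m, Function.update f m a i = f i := fun i hi =>
      Function.update_of_ne hi.ne _ _
    have hwlt : ∀ i ≤ m, Function.update w (m + 1) (p a) i = w i := fun i hi =>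
      Function.update_of_ne (by omega) _ _
    refine ⟨Function.update f m a, Function.update w (m + 1) (p a), ?_, ?_, ?_, ?_⟩
    · rw [hwlt 0 (by omega), hw0]
    · simp
    · intro i hi
      rcases Nat.lt_succ_iff_lt_or_eq.1 hi with h' | rfl
      · rw [hlt i h', hwlt i h'.le, hwlt (i + 1) h']
        obtain ⟨h1, h2, h3⟩ := hf i h'
        exact ⟨Finset.mem_of_mem_erase h1, h2, h3⟩
      · rw [hwlt i le_rfl]
        simp [haS, hwm]
    · intro i hi j hj hij
      rcases Nat.lt_succ_iff_lt_or_eq.1 hi with h1 | rfl <;>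
        rcases Nat.lt_succ_iff_lt_or_eq.1 hj with h2 | rfl
      · rw [hlt i h1, hlt j h2] at hij
        exact hinj i h1 j h2 hij
      · rw [hlt i h1, Function.update_self] at hij
        exact absurd hij (Finset.ne_of_mem_erase (hf i h1).1)
      · rw [hlt j h2, Function.update_self] at hij
        exact absurd hij.symm (Finset.ne_of_mem_erase (hf j h2).1)
      · rfl

end Trails

/-! ### Iterated partial derivatives indexed by multisets. -/

section Derivatives

variable {σ : Type*}

/-- The commutator is again a derivation, so it suffices that it kills the variables. -/
theorem pderiv_pderiv_comm (i j : σ) (P : MvPolynomial σ ℚ) :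
    MvPolynomial.pderiv i (MvPolynomial.pderiv j P) =
      MvPolynomial.pderiv j (MvPolynomial.pderiv i P) := by
  classical
  have h : ⁅(MvPolynomial.pderiv i : Derivation ℚ (MvPolynomial σ ℚ) (MvPolynomial σ ℚ)),
      (MvPolynomial.pderiv j : Derivation ℚ (MvPolynomial σ ℚ) (MvPolynomial σ ℚ))⁆ = 0 := by
    refine MvPolynomial.derivation_ext fun l => ?_
    rw [Derivation.commutator_apply, MvPolynomial.pderiv_X, MvPolynomial.pderiv_X]
    have h (a b c : σ) : MvPolynomial.pderiv a
        (Pi.single (M := fun _ => MvPolynomial σ ℚ) b 1 c) = 0 := by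
      by_cases hb : b = c
      · subst hb; simp
      · simp [Ne.symm hb]
    simp [h]
  have := congrArg (fun D : Derivation ℚ (MvPolynomial σ ℚ) (MvPolynomial σ ℚ) => D P) h
  simpa [Derivation.commutator_apply, sub_eq_zero] using this

instance leftCommutative_pderiv_mul :
    LeftCommutative fun (a : σ) (L : Module.End ℚ (MvPolynomial σ ℚ)) =>
      ((MvPolynomial.pderiv a).toLinearMap : Module.End ℚ (MvPolynomial σ ℚ)) * L where
  left_comm a b L := LinearMap.ext fun P => pderiv_pderiv_comm a b (L P)

/-- The partial derivative with respect to all variables of a multiset. -/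
def iterDeriv (s : Multiset σ) : Module.End ℚ (MvPolynomial σ ℚ) :=
  s.foldr (fun a L => ((MvPolynomial.pderiv a).toLinearMap :
    Module.End ℚ (MvPolynomial σ ℚ)) * L) 1

@[simp]
theorem iterDeriv_zero : iterDeriv (0 : Multiset σ) = 1 := rfl

theorem iterDeriv_cons (a : σ) (s : Multiset σ) :
    iterDeriv (a ::ₘ s) =
      ((MvPolynomial.pderiv a).toLinearMap : Module.End ℚ (MvPolynomial σ ℚ)) * iterDeriv s :=
  Multiset.foldr_cons _ _ _ _

theorem iterDeriv_cons_apply (a : σ) (s : Multiset σ) (P : MvPolynomial σ ℚ) :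
    iterDeriv (a ::ₘ s) P = MvPolynomial.pderiv a (iterDeriv s P) := by
  rw [iterDeriv_cons]; rfl

theorem iterDeriv_add (s t : Multiset σ) : iterDeriv (s + t) = iterDeriv s * iterDeriv t := by
  induction s using Multiset.induction with
  | empty => simp
  | cons a s ih => rw [Multiset.cons_add, iterDeriv_cons, iterDeriv_cons, ih, mul_assoc]

theorem iterDeriv_cons_apply' (a : σ) (s : Multiset σ) (P : MvPolynomial σ ℚ) :
    iterDeriv (a ::ₘ s) P = iterDeriv s (MvPolynomial.pderiv a P) := by
  rw [← Multiset.singleton_add, add_comm, iterDeriv_add, ← Multiset.cons_zero, iterDeriv_cons]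
  rfl

theorem iterDeriv_coe_map (l : List σ) :
    iterDeriv (l : Multiset σ) = (l.map fun a => ((MvPolynomial.pderiv a).toLinearMap :
      Module.End ℚ (MvPolynomial σ ℚ))).prod := by
  induction l with
  | nil => rfl
  | cons a l ih => rw [← Multiset.cons_coe, iterDeriv_cons, ih, List.map_cons, List.prod_cons]

theorem pderiv_rename {τ : Type*} (ρ : σ ≃ τ) (a : σ) (P : MvPolynomial σ ℚ) :
    MvPolynomial.pderiv (ρ a) (MvPolynomial.rename ρ P) =
      MvPolynomial.rename ρ (MvPolynomial.pderiv a P) := by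
  classical
  induction P using MvPolynomial.induction_on with
  | C c => simp
  | add P Q hP hQ => simp [hP, hQ]
  | mul_X P i hP =>
    simp only [map_mul, MvPolynomial.rename_X, Derivation.leibniz, smul_eq_mul, hP, map_add,
      MvPolynomial.pderiv_X]
    congr 2
    by_cases h : a = i
    · subst h; simp
    · simp [Ne.symm h]

theorem iterDeriv_map_rename {τ : Type*} (ρ : σ ≃ τ) (s : Multiset σ) (P : MvPolynomial σ ℚ) :
    iterDeriv (s.map ρ) (MvPolynomial.rename ρ P) = MvPolynomial.rename ρ (iterDeriv s P) := by
  induction s using Multiset.induction with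
  | empty => simp
  | cons a s ih => rw [Multiset.map_cons, iterDeriv_cons_apply, ih, pderiv_rename,
      iterDeriv_cons_apply]

variable [DecidableEq σ] {α : Type*} [DecidableEq α]

/-- Leibniz rule: at most one derivative hits the linear factor. Indexing by labels `a ∈ S` keeps
repeated derivatives distinguishable, as parallel arcs must be. -/
theorem iterDeriv_mul_X (g : α → σ) (S : Finset α) (e : σ) (P : MvPolynomial σ ℚ) :
    iterDeriv (S.val.map g) (P * MvPolynomial.X e) =
      iterDeriv (S.val.map g) P * MvPolynomial.X e +
        ∑ a ∈ S with g a = e, iterDeriv ((S.erase a).val.map g) P := by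
  induction S using Finset.induction_on with
  | empty => simp
  | insert b S hb ih =>
    have herase : ∀ a ∈ S.filter (fun a => g a = e),
        iterDeriv (((insert b S).erase a).val.map g) P =
          MvPolynomial.pderiv (g b) (iterDeriv ((S.erase a).val.map g) P) := by
      intro a ha
      have hab : b ≠ a := by
        rintro rfl
        exact hb (Finset.mem_filter.1 ha).1
      rw [Finset.erase_insert_of_ne hab, Finset.insert_val_of_notMem
        (fun h => hb (Finset.mem_of_mem_erase h)), Multiset.map_cons, iterDeriv_cons_apply]
    rw [Finset.insert_val_of_notMem hb, Multiset.map_cons, iterDeriv_cons_apply, ih,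
      iterDeriv_cons_apply, map_add, map_sum, Derivation.leibniz, MvPolynomial.pderiv_X,
      Finset.filter_insert, smul_eq_mul, smul_eq_mul, mul_comm (MvPolynomial.X e)]
    split_ifs with h
    · subst h
      rw [Finset.sum_insert (by simp [hb]), Finset.sum_congr rfl herase, Finset.erase_insert hb,
        Pi.single_eq_same]
      ring
    · rw [Finset.sum_congr rfl herase, Pi.single_eq_of_ne (Ne.symm h)]
      ring

end Derivatives

/-! ### Derivatives of powers of the generic matrix and of their traces. -/

section GenericMatrix

variable {n : ℕ}

/-- The generic matrix. -/
abbrev genericMatrix (n : ℕ) : Matrix (Fin n) (Fin n) (EntryPoly n) :=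
  Matrix.mvPolynomialX (Fin n) (Fin n) ℚ

variable {α : Type*} [DecidableEq α] (p q : α → Fin n)

/-- The last matrix factor is either left alone or differentiated by an arc ending at `u`; walks are
therefore peeled off from their end, against the arcs. -/
theorem iterDeriv_genericMatrix_pow_succ (m : ℕ) (S : Finset α) (r u : Fin n) :
    iterDeriv (S.val.map fun a => (q a, p a)) ((genericMatrix n ^ (m + 1)) r u) =
      ∑ w, iterDeriv (S.val.map fun a => (q a, p a)) ((genericMatrix n ^ m) r w) *
        MvPolynomial.X (w, u) +
      ∑ a ∈ S with p a = u,
        iterDeriv ((S.erase a).val.map fun a => (q a, p a)) ((genericMatrix n ^ m) r (q a)) := by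
  rw [pow_succ, Matrix.mul_apply, map_sum]
  simp only [Matrix.mvPolynomialX_apply, iterDeriv_mul_X, Finset.sum_add_distrib]
  congr 1
  simp only [Prod.mk.injEq, Finset.sum_filter]
  rw [Finset.sum_comm]
  refine Finset.sum_congr rfl fun a _ => ?_
  rw [Finset.sum_eq_single (q a)]
  · simp
  · intro b _ hb
    rw [if_neg]
    exact fun h => hb h.1.symm
  · simp

theorem iterDeriv_genericMatrix_pow_eq_zero (m : ℕ) (S : Finset α) (hS : m < S.card)
    (r u : Fin n) :
    iterDeriv (S.val.map fun a => (q a, p a)) ((genericMatrix n ^ m) r u) = 0 := by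
  induction m generalizing S u with
  | zero =>
    obtain ⟨a, ha⟩ := Finset.card_pos.1 hS
    rw [← Finset.insert_erase ha, Finset.insert_val_of_notMem (Finset.notMem_erase _ _),
      Multiset.map_cons, iterDeriv_cons_apply', pow_zero, Matrix.one_apply]
    split_ifs <;> simp
  | succ m ih =>
    rw [iterDeriv_genericMatrix_pow_succ, Finset.sum_eq_zero, Finset.sum_eq_zero, add_zero]
    · intro a ha
      refine ih _ ?_ _
      rw [Finset.card_erase_of_mem (Finset.mem_filter.1 ha).1]
      omega
    · intro w _
      rw [ih S (by omega) w, zero_mul]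

/-- When the order equals the degree, the terms with an undifferentiated last factor vanish, and
what is left is the recursion defining `trails`. -/
theorem iterDeriv_genericMatrix_pow (m : ℕ) (S : Finset α) (hS : S.card = m) (r u : Fin n) :
    iterDeriv (S.val.map fun a => (q a, p a)) ((genericMatrix n ^ m) r u) =
      MvPolynomial.C (trails p q r m S u : ℚ) := by
  induction m generalizing S u with
  | zero =>
    rw [Finset.card_eq_zero] at hS
    subst hS
    by_cases h : u = r
    · simp [trails, h]
    · simp [trails, h, Ne.symm h]
  | succ m ih =>
    rw [iterDeriv_genericMatrix_pow_succ, Finset.sum_eq_zero, zero_add, trails, Nat.cast_sum,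
      map_sum]
    · refine Finset.sum_congr rfl fun a ha => ih _ ?_ _
      rw [Finset.card_erase_of_mem (Finset.mem_filter.1 ha).1]
      omega
    · intro w _
      rw [iterDeriv_genericMatrix_pow_eq_zero _ _ _ _ (by omega), zero_mul]

theorem map_pderiv_mul (e : Fin n × Fin n) (M N : Matrix (Fin n) (Fin n) (EntryPoly n)) :
    (M * N).map (MvPolynomial.pderiv e) =
      M.map (MvPolynomial.pderiv e) * N + M * N.map (MvPolynomial.pderiv e) := by
  refine Matrix.ext fun i j => ?_
  simp only [Matrix.map_apply, Matrix.mul_apply, Matrix.add_apply, map_sum, Derivation.leibniz,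
    smul_eq_mul, ← Finset.sum_add_distrib]
  refine Finset.sum_congr rfl fun l _ => ?_
  ring

/-- Each of the `N + 1` factors contributes equally by cyclicity of the trace. The extra factor `M ^
m` makes the induction go through. -/
theorem trace_map_pderiv_pow_mul (e : Fin n × Fin n) (M : Matrix (Fin n) (Fin n) (EntryPoly n))
    (N m : ℕ) :
    ((M ^ (N + 1)).map (MvPolynomial.pderiv e) * M ^ m).trace =
      ((N : EntryPoly n) + 1) * (M ^ (N + m) * M.map (MvPolynomial.pderiv e)).trace := by
  induction N generalizing m with
  | zero => simp [Matrix.trace_mul_comm (M ^ m)]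
  | succ N ih =>
    rw [pow_succ, map_pderiv_mul, add_mul, mul_assoc, ← pow_succ', Matrix.trace_add, ih,
      mul_assoc (M ^ (N + 1)), Matrix.trace_mul_comm (M ^ (N + 1)), mul_assoc,
      Matrix.trace_mul_comm (M.map _), ← pow_add]
    rw [show m + (N + 1) = N + (m + 1) by ring, show N + 1 + m = N + (m + 1) by ring]
    push_cast
    ring

theorem pderiv_trace_pow (i j : Fin n) (N : ℕ) :
    MvPolynomial.pderiv (i, j) (genericMatrix n ^ (N + 1)).trace =
      ((N : ℚ) + 1) • (genericMatrix n ^ N) j i := by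
  have h := trace_map_pderiv_pow_mul (i, j) (genericMatrix n) N 0
  have hX : (genericMatrix n).map (MvPolynomial.pderiv (i, j)) = Matrix.single i j 1 := by
    refine Matrix.ext fun a b => ?_
    change MvPolynomial.pderiv (i, j) (MvPolynomial.X (a, b)) = _
    rw [MvPolynomial.pderiv_X, Matrix.single_apply,
      Pi.single_apply]
    simp only [Prod.mk.injEq, @eq_comm _ a, @eq_comm _ b]
  rw [pow_zero, mul_one, add_zero, hX, Matrix.trace_mul_single] at h
  have hl : ((genericMatrix n ^ (N + 1)).map (MvPolynomial.pderiv (i, j))).trace =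
      MvPolynomial.pderiv (i, j) (genericMatrix n ^ (N + 1)).trace := by
    simp [Matrix.trace, map_sum]
  rw [← hl, h, MvPolynomial.smul_eq_C_mul]
  simp

theorem rename_trace_pow (π : Equiv.Perm (Fin n)) (N : ℕ) :
    MvPolynomial.rename (Equiv.prodCongr π π) (genericMatrix n ^ N).trace =
      (genericMatrix n ^ N).trace := by
  have h1 : (genericMatrix n).map (MvPolynomial.rename (Equiv.prodCongr π π)) =
      (genericMatrix n).submatrix π π := by
    refine Matrix.ext fun a b => ?_
    simp
  have h3 : MvPolynomial.rename (Equiv.prodCongr π π) (genericMatrix n ^ N).trace =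
      ((MvPolynomial.rename (R := ℚ) (Equiv.prodCongr π π)).mapMatrix
        (genericMatrix n ^ N)).trace := by
    simp [Matrix.trace, map_sum]
  rw [h3, map_pow]
  change Matrix.trace (((genericMatrix n).map (MvPolynomial.rename (Equiv.prodCongr π π))) ^ N) = _
  rw [h1]
  have h2 : ((genericMatrix n).submatrix π π) ^ N = (genericMatrix n ^ N).submatrix π π := by
    clear h3
    induction N with
    | zero => simp
    | succ N ih => rw [pow_succ, pow_succ, ih, Matrix.submatrix_mul_equiv]
  rw [h2]
  simp only [Matrix.trace, Matrix.diag_apply, Matrix.submatrix_apply]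
  exact Equiv.sum_comp π fun i => (genericMatrix n ^ N) i i

end GenericMatrix

/-! ### Derivatives along the arcs of a digraph. -/

theorem val_finRotate {N : ℕ} (i : Fin N) : (finRotate N i : ℕ) = (i + 1) % N := by
  cases N with
  | zero => exact i.elim0
  | succ N => rw [finRotate_apply, Fin.val_add, Fin.val_one', Nat.add_mod_mod]

namespace MultiDigraph

variable {n : ℕ} (D : MultiDigraph n)

/-- The multiset of pairs (source, target) of the arcs. -/
def arcPairs : Multiset (Fin n × Fin n) :=
  (Finset.univ : Finset D.Arc).val.map fun a => (D.src a, D.tgt a)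

variable {D}

open scoped Classical in
theorem IsEulerian.arcDeg_eq (h : D.IsEulerian) (v : Fin n) :
    arcDeg D.tgt Finset.univ v = arcDeg D.src Finset.univ v := by
  obtain ⟨t, ht⟩ := h
  refine Finset.card_equiv ((t.symm.trans (finRotate _)).trans t) fun a => ?_
  have := ht (t.symm a)
  rw [Equiv.apply_symm_apply] at this
  simp [this]

theorem IsEulerian.verts_eq (h : D.IsEulerian) : D.verts = Finset.univ.image D.tgt := by
  classical
  have : (Finset.univ : Finset D.Arc).image D.src = Finset.univ.image D.tgt := by
    ext v
    rw [← arcDeg_pos_iff_mem_image, ← arcDeg_pos_iff_mem_image, h.arcDeg_eq]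
  rw [verts, this, Finset.union_self]

theorem isEulerian_of_trails_ne_zero [DecidableEq D.Arc] [Nonempty D.Arc] (r : Fin n)
    (h : trails D.tgt D.src r (Fintype.card D.Arc) Finset.univ r ≠ 0) : D.IsEulerian := by
  obtain ⟨f, w, hw0, hwN, hf, hinj⟩ := exists_walk_of_trails_ne_zero _ _ _ h
  have hbij : Function.Bijective fun i : Fin (Fintype.card D.Arc) => f i := by
    rw [Fintype.bijective_iff_injective_and_card]
    refine ⟨fun i j hij => Fin.ext (hinj i i.2 j j.2 hij), by simp⟩
  refine ⟨Equiv.ofBijective _ hbij, fun i => ?_⟩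
  simp only [Equiv.ofBijective_apply]
  rw [(hf i i.2).2.2, val_finRotate, (hf _ (Nat.mod_lt _ Fintype.card_pos)).2.1]
  rcases Nat.lt_or_ge (i + 1) (Fintype.card D.Arc) with h1 | h1
  · rw [Nat.mod_eq_of_lt h1]
  · have h2 : (i : ℕ) + 1 = Fintype.card D.Arc := by have := i.2; omega
    rw [h2, Nat.mod_self, hw0, hwN]

/-- Each diagonal entry contributes a number of closed trails through all arcs, and any such trail
is an Euler tour. -/
theorem iterDeriv_arcPairs_of_not_isEulerian [Nonempty D.Arc] (h : ¬ D.IsEulerian) :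
    iterDeriv D.arcPairs (genericMatrix n ^ Fintype.card D.Arc).trace = 0 := by
  classical
  rw [Matrix.trace, map_sum]
  refine Finset.sum_eq_zero fun r _ => ?_
  rw [Matrix.diag_apply, arcPairs,
    iterDeriv_genericMatrix_pow D.tgt D.src (Fintype.card D.Arc) _ Finset.card_univ]
  have : trails D.tgt D.src r (Fintype.card D.Arc) Finset.univ r = 0 := by
    by_contra h'
    exact h (isEulerian_of_trails_ne_zero r h')
  rw [this]
  simp

open scoped Classical in
theorem IsEulerian.numArborescences_eq (h : D.IsEulerian) (r : Fin n) :
    D.numArborescences r = (spanningTrees D.tgt D.src r Finset.univ).card := by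
  refine Nat.subtype_card _ fun T => ?_
  rw [mem_spanningTrees]
  constructor
  · intro hT
    refine ⟨hT.root, fun v hv hvr => hT.unique v hvr (h.verts_eq ▸ hv), fun v hv => ?_⟩
    by_cases hvr : v = r
    · rw [hvr]
    · exact hT.reach v hvr (h.verts_eq ▸ hv)
  · intro hT
    exact ⟨Finset.subset_univ _, hT.root, fun v hvr hv => hT.unique v (h.verts_eq ▸ hv) hvr,
      fun v _ hv => hT.reach v (h.verts_eq ▸ hv)⟩

/-- Differentiate first along an arc `a` entering `r`; the other arcs must form a trail from `r` to
the source of `a`. Removing `a` turns the root's factor into `(deg⁻ r - 1)!`, like that of every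
other vertex. -/
theorem IsEulerian.iterDeriv_arcPairs (h : D.IsEulerian) {r : Fin n} (hr : r ∈ D.verts) :
    iterDeriv D.arcPairs (genericMatrix n ^ Fintype.card D.Arc).trace =
      MvPolynomial.C ((Fintype.card D.Arc : ℚ) *
        (D.numArborescences r * ∏ v, ((D.inDeg v - 1).factorial : ℚ))) := by
  classical
  rw [h.verts_eq] at hr
  obtain ⟨a, -, ha⟩ := Finset.mem_image.1 hr
  have hpos : 0 < Fintype.card D.Arc := Fintype.card_pos_iff.2 ⟨a⟩
  obtain ⟨N, hN⟩ := Nat.exists_eq_succ_of_ne_zero hpos.ne'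
  have hcard : ((Finset.univ : Finset D.Arc).erase a).card = N := by
    rw [Finset.card_erase_of_mem (Finset.mem_univ _), Finset.card_univ, hN]; rfl
  have hd : ∀ v, arcDeg D.tgt (Finset.univ.erase a) v + (if v = r then 1 else 0) =
      D.inDeg v := by
    intro v
    have := arcDeg_erase (p := D.tgt) (Finset.mem_univ a) v
    rwa [ha] at this
  have htrails := trails_eq (p := D.tgt) (q := D.src) (r := r) N (Finset.univ.erase a) (D.src a)
    hcard (by
      intro v
      have h2 := arcDeg_erase (p := D.src) (Finset.mem_univ a) v
      have h3 := h.arcDeg_eq v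
      have h4 : arcDeg D.tgt Finset.univ v = D.inDeg v := rfl
      rw [hd v]
      omega)
  have hr0 : arcDeg D.tgt (Finset.univ.erase a) r = D.inDeg r - 1 := by
    have := hd r
    rw [if_pos rfl] at this
    omega
  have hprod : ∏ v ∈ Finset.univ.erase r,
        (arcDeg D.tgt (Finset.univ.erase a) v - 1).factorial =
      ∏ v ∈ Finset.univ.erase r, (D.inDeg v - 1).factorial := by
    refine Finset.prod_congr rfl fun v hv => ?_
    have := hd v
    rw [if_neg (Finset.ne_of_mem_erase hv)] at this
    rw [← this, add_zero]
  rw [spanningTrees_erase_root ha, hr0, hprod,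
    Finset.mul_prod_erase _ (fun v => (D.inDeg v - 1).factorial) (Finset.mem_univ r),
    ← h.numArborescences_eq] at htrails
  rw [arcPairs, ← Finset.insert_erase (Finset.mem_univ a),
    Finset.insert_val_of_notMem (Finset.notMem_erase _ _), Multiset.map_cons,
    iterDeriv_cons_apply', hN, pderiv_trace_pow, map_smul, iterDeriv_genericMatrix_pow _ _ _ _ hcard,
    ha, htrails, MvPolynomial.smul_eq_C_mul, ← map_mul]
  push_cast
  rfl

end MultiDigraph

/-! ### Star sequences and their weights. -/

theorem sum_singleton_eq_map {α β : Type*} (s : Finset α) (f : α → β) :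
    ∑ a ∈ s, ({f a} : Multiset β) = s.val.map f := by
  rw [← Multiset.sum_map_singleton (s.val.map f), Multiset.map_map]
  rfl

namespace StarSeq

variable {n m : ℕ}

/-- The multiset of arcs of the stars of `R`, as pairs (source, target). -/
def arcs (R : StarSeq n m) : Multiset (Fin n × Fin n) :=
  ∑ t, ((R t).1.erase (R t).2).val.map fun w => ((R t).2, w)

/-- The number of stars of `R` with root `v`. -/
def rootCount (R : StarSeq n m) (v : Fin n) : ℕ :=
  (Finset.univ.filter fun t => (R t).2 = v).card

/-- Every root lies in its edge, and all edges have `k` vertices. -/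
def IsUniform (k : ℕ) (R : StarSeq n m) : Prop :=
  ∀ t, (R t).2 ∈ (R t).1 ∧ (R t).1.card = k

/-- The contribution of `R` to the generalized trace. -/
def weight (k : ℕ) (R : StarSeq n m) : ℚ :=
  MvPolynomial.constantCoeff (iterDeriv R.arcs (genericMatrix n ^ (m * (k - 1))).trace) /
    ∏ v, ((R.rootCount v * (k - 1)).factorial : ℚ)

theorem arcPairs_digraph (R : StarSeq n m) : R.digraph.arcPairs = R.arcs := by
  have h1 : R.digraph.arcPairs =
      ∑ a : {p : Fin m × Fin n // p.2 ∈ (R p.1).1 ∧ p.2 ≠ (R p.1).2},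
        {((R a.1.1).2, a.1.2)} := by
    rw [sum_singleton_eq_map]
    rfl
  have h2 : ∀ t, ((R t).1.erase (R t).2).val.map (fun w => ((R t).2, w)) =
      ∑ w, if w ∈ (R t).1 ∧ w ≠ (R t).2 then {((R t).2, w)} else 0 := by
    intro t
    rw [← Finset.sum_filter, sum_singleton_eq_map]
    congr 2
    ext w
    simp [and_comm]
  rw [h1, arcs, Finset.sum_congr rfl fun t _ => h2 t, ← Fintype.sum_prod_type', ← Finset.sum_filter]
  symm
  exact Finset.sum_subtype _ (by simp) _

variable {R : StarSeq n m} {k : ℕ}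

theorem card_arcs (hR : R.IsUniform k) : R.arcs.card = m * (k - 1) := by
  rw [arcs, Multiset.card_sum]
  have : ∀ t, (((R t).1.erase (R t).2).val.map fun w => ((R t).2, w)).card = k - 1 := by
    intro t
    rw [Multiset.card_map, Finset.card_val, Finset.card_erase_of_mem (hR t).1, (hR t).2]
  rw [Finset.sum_congr rfl fun t _ => this t]
  simp

theorem card_arc_digraph (hR : R.IsUniform k) : Fintype.card R.digraph.Arc = m * (k - 1) := by
  rw [← card_arcs hR, ← arcPairs_digraph, MultiDigraph.arcPairs, Multiset.card_map,
    Finset.card_val, Finset.card_univ]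

theorem countP_arcs_fst (hR : R.IsUniform k) (v : Fin n) :
    R.arcs.countP (fun e => e.1 = v) = R.rootCount v * (k - 1) := by
  rw [arcs, ← Multiset.coe_countPAddMonoidHom, map_sum]
  simp only [Multiset.coe_countPAddMonoidHom]
  have : ∀ t, (((R t).1.erase (R t).2).val.map fun w => ((R t).2, w)).countP
      (fun e => e.1 = v) = if (R t).2 = v then k - 1 else 0 := by
    intro t
    rw [Multiset.countP_map]
    split_ifs with h
    · simp only [h, Multiset.filter_true]
      rw [Finset.card_val, ← h, Finset.card_erase_of_mem (hR t).1, (hR t).2]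
    · simp [h]
  simp only [this]
  rw [← Finset.sum_filter, Finset.sum_const, smul_eq_mul, rootCount]

/-- Each edge through `v` meets it either as its root or as the target of one arc. -/
theorem countP_arcs_snd (hR : R.IsUniform k) (v : Fin n) :
    R.arcs.countP (fun e => e.2 = v) + R.rootCount v =
      (Finset.univ.filter fun t => v ∈ (R t).1).card := by
  rw [arcs, ← Multiset.coe_countPAddMonoidHom, map_sum]
  simp only [Multiset.coe_countPAddMonoidHom]
  have : ∀ t, (((R t).1.erase (R t).2).val.map fun w => ((R t).2, w)).countP
      (fun e => e.2 = v) + (if (R t).2 = v then 1 else 0) = if v ∈ (R t).1 then 1 else 0 := by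
    intro t
    rw [Multiset.countP_map]
    have h1 : ((((R t).1.erase (R t).2).val.filter fun a => a = v)).card =
        if v ∈ (R t).1.erase (R t).2 then 1 else 0 := by
      rw [← Multiset.countP_eq_card_filter]
      simp_rw [@eq_comm _ _ v]
      change Multiset.count v _ = _
      exact Multiset.count_eq_of_nodup (Finset.nodup _)
    rw [h1]
    by_cases h : (R t).2 = v
    · have := (hR t).1
      rw [h] at this
      simp [h, this]
    · simp [h, Ne.symm h]
  rw [rootCount, Finset.card_filter, Finset.card_filter, ← Finset.sum_add_distrib]
  exact Finset.sum_congr rfl fun t _ => this t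

theorem arcDeg_src_digraph [DecidableEq R.digraph.Arc] (v : Fin n) :
    arcDeg R.digraph.src Finset.univ v = R.arcs.countP (fun e => e.1 = v) := by
  rw [← arcPairs_digraph, MultiDigraph.arcPairs, Multiset.countP_map]
  rfl

theorem inDeg_digraph (v : Fin n) :
    R.digraph.inDeg v = R.arcs.countP (fun e => e.2 = v) := by
  rw [← arcPairs_digraph, MultiDigraph.arcPairs, Multiset.countP_map]
  rfl

theorem inDeg_eq_rootCount_mul (hR : R.IsUniform k) (h : R.digraph.IsEulerian) (v : Fin n) :
    R.digraph.inDeg v = R.rootCount v * (k - 1) := by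
  classical
  rw [← countP_arcs_fst hR, ← arcDeg_src_digraph, ← h.arcDeg_eq]
  rfl

theorem nonempty_arc_digraph (hR : R.IsUniform k) (hk : 2 ≤ k) (hm : 1 ≤ m) :
    Nonempty R.digraph.Arc := by
  rw [← Fintype.card_pos_iff, card_arc_digraph hR]
  exact Nat.mul_pos hm (by omega)

theorem iterDeriv_arcs_eq_C (hR : R.IsUniform k) (hk : 2 ≤ k) (hm : 1 ≤ m) :
    iterDeriv R.arcs (genericMatrix n ^ (m * (k - 1))).trace =
      MvPolynomial.C (MvPolynomial.constantCoeff
        (iterDeriv R.arcs (genericMatrix n ^ (m * (k - 1))).trace)) := by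
  obtain ⟨a⟩ := nonempty_arc_digraph hR hk hm
  have : Nonempty R.digraph.Arc := ⟨a⟩
  rw [← card_arc_digraph hR, ← arcPairs_digraph]
  by_cases h : R.digraph.IsEulerian
  · rw [h.iterDeriv_arcPairs (r := R.digraph.tgt a), MvPolynomial.constantCoeff_C]
    rw [h.verts_eq]
    exact Finset.mem_image_of_mem _ (Finset.mem_univ _)
  · rw [MultiDigraph.iterDeriv_arcPairs_of_not_isEulerian h]
    simp

theorem weight_of_not_isEulerian (hR : R.IsUniform k) (hk : 2 ≤ k) (hm : 1 ≤ m)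
    (h : ¬ R.digraph.IsEulerian) : R.weight k = 0 := by
  have := nonempty_arc_digraph hR hk hm
  rw [weight, ← card_arc_digraph hR, ← arcPairs_digraph,
    MultiDigraph.iterDeriv_arcPairs_of_not_isEulerian h]
  simp

theorem weight_of_isEulerian (hR : R.IsUniform k) (h : R.digraph.IsEulerian) {r : Fin n}
    (hr : r ∈ R.digraph.verts) :
    R.weight k = (m * (k - 1) : ℕ) * ((R.digraph.numArborescences r : ℚ) /
      ∏ v ∈ R.digraph.verts, (R.digraph.inDeg v : ℚ)) := by
  classical
  have h1 : ∏ v, ((R.digraph.inDeg v).factorial : ℚ) =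
      (∏ v ∈ R.digraph.verts, (R.digraph.inDeg v : ℚ)) *
        ∏ v, ((R.digraph.inDeg v - 1).factorial : ℚ) := by
    have h0 : ∀ v, v ∉ R.digraph.verts → R.digraph.inDeg v = 0 := by
      intro v hv
      rw [h.verts_eq, ← arcDeg_pos_iff_mem_image] at hv
      exact Nat.eq_zero_of_not_pos hv
    rw [← Finset.prod_subset (Finset.subset_univ R.digraph.verts)
        (f := fun v => ((R.digraph.inDeg v).factorial : ℚ)) fun v _ hv => by simp [h0 v hv],
      ← Finset.prod_subset (Finset.subset_univ R.digraph.verts)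
        (f := fun v => ((R.digraph.inDeg v - 1).factorial : ℚ)) fun v _ hv => by simp [h0 v hv],
      ← Finset.prod_mul_distrib]
    refine Finset.prod_congr rfl fun v hv => ?_
    rw [h.verts_eq, ← arcDeg_pos_iff_mem_image] at hv
    change 0 < R.digraph.inDeg v at hv
    rw [← Nat.mul_factorial_pred hv.ne', Nat.cast_mul]
  rw [weight, ← card_arc_digraph hR, ← arcPairs_digraph, h.iterDeriv_arcPairs hr,
    MvPolynomial.constantCoeff_C]
  simp only [← inDeg_eq_rootCount_mul hR h]
  rw [h1, ← mul_assoc, mul_div_mul_right, mul_div_assoc]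
  exact Finset.prod_ne_zero_iff.2 fun v _ => by positivity

end StarSeq

/-! ### Expansion of the generalized trace over star sequences. -/

section TraceExpansion

variable {n k : ℕ}

/-- The number of functions from a `(k-1)`-set that enumerate the edge `e` without `i`. -/
theorem card_enumerations (hk : 2 ≤ k) {e : Finset (Fin n)} {i : Fin n} (he : e.card = k)
    (hi : i ∈ e) :
    (Finset.univ.filter fun j : Fin (k - 1) → Fin n => insert i (Finset.univ.image j) = e).card =
      (k - 1).factorial := by
  have h1 : Fintype.card (Fin (k - 1) ↪ {x // x ∈ e.erase i}) = (k - 1).factorial := by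
    rw [Fintype.card_embedding_eq, Fintype.card_coe, Finset.card_erase_of_mem hi, he,
      Fintype.card_fin, Nat.descFactorial_self]
  rw [← h1, ← Finset.card_univ]
  symm
  refine Finset.card_bij (fun f _ t => (f t : Fin n)) ?_ ?_ ?_
  · intro f _
    rw [Finset.mem_filter]
    refine ⟨Finset.mem_univ _, ?_⟩
    have : Finset.univ.image (fun t => (f t : Fin n)) = e.erase i := by
      refine Finset.eq_of_subset_of_card_le ?_ ?_
      · intro x hx
        obtain ⟨t, -, rfl⟩ := Finset.mem_image.1 hx
        exact (f t).2
      · rw [Finset.card_image_of_injective _ (f := fun t => (f t : Fin n))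
          (Subtype.val_injective.comp f.injective), Finset.card_erase_of_mem hi, he,
          Finset.card_univ, Fintype.card_fin]
    rw [this, Finset.insert_erase hi]
  · intro f _ g _ hfg
    ext t
    exact congrArg Fin.val (congrFun hfg t)
  · intro j hj
    have hj := (Finset.mem_filter.1 hj).2
    have hle : (Finset.univ.image j).card ≤ k - 1 := by
      simpa using Finset.card_image_le (s := Finset.univ) (f := j)
    -- Otherwise the `k - 1` values of `j` would cover all `k` elements of `e`.
    have hni : i ∉ Finset.univ.image j := by
      intro h
      rw [Finset.insert_eq_of_mem h] at hj
      rw [hj] at hle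
      omega
    have hcard : (Finset.univ.image j).card = k - 1 := by
      have := Finset.card_insert_of_notMem hni
      rw [hj, he] at this
      omega
    have hinj : Function.Injective j := by
      have : Set.InjOn j (Finset.univ : Finset (Fin (k - 1))) := by
        rw [← Finset.card_image_iff, hcard]
        simp
      simpa using this
    have hmem : ∀ t, j t ∈ e.erase i := by
      intro t
      have ht : j t ∈ Finset.univ.image j := Finset.mem_image_of_mem _ (Finset.mem_univ _)
      refine Finset.mem_erase.2 ⟨fun h => hni (h ▸ ht), ?_⟩
      rw [← hj]
      exact Finset.mem_insert_of_mem ht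
    refine ⟨⟨fun t => ⟨j t, hmem t⟩, fun s t hst => hinj (congrArg Subtype.val hst)⟩,
      Finset.mem_univ _, rfl⟩

theorem map_eq_of_insert_image_eq {e : Finset (Fin n)} {i : Fin n}
    (he : e.card = k) (hi : i ∈ e)
    {j : Fin (k - 1) → Fin n} (hj : insert i (Finset.univ.image j) = e) :
    Finset.univ.val.map j = (e.erase i).val := by
  have hle : (Finset.univ.image j).card ≤ k - 1 := by
    simpa using Finset.card_image_le (s := Finset.univ) (f := j)
  have hsub : e.erase i ⊆ Finset.univ.image j := by
    rw [← hj]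
    exact Finset.erase_insert_subset _ _
  have hcard : (e.erase i).card = k - 1 := by rw [Finset.card_erase_of_mem hi, he]
  have heq : e.erase i = Finset.univ.image j := Finset.eq_of_subset_of_card_le hsub (by omega)
  rw [heq]
  have hinj : Set.InjOn j (Finset.univ : Finset (Fin (k - 1))) := by
    rw [← Finset.card_image_iff, ← heq, hcard]
    simp
  exact (Finset.image_val_of_injOn hinj).symm

open scoped Classical in
theorem KGraph.op_adjacency (hk : 2 ≤ k) (𝓗 : KGraph n k) (i : Fin n) :
    𝓗.adjacency.op i = ∑ e : Finset (Fin n), (if e ∈ 𝓗.edges ∧ i ∈ e then (1 : ℚ) else 0) •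
      iterDeriv ((e.erase i).val.map fun w => (i, w)) := by
  rw [Hypermatrix.op, ← Finset.sum_fiberwise (s := Finset.univ)
    (g := fun j : Fin (k - 1) → Fin n => insert i (Finset.univ.image j))]
  refine Finset.sum_congr rfl fun e _ => ?_
  by_cases he : e ∈ 𝓗.edges
  · by_cases hi : i ∈ e
    · have hek := 𝓗.card_edge e he
      have : ∀ j ∈ Finset.univ.filter
          (fun j : Fin (k - 1) → Fin n => insert i (Finset.univ.image j) = e),
          𝓗.adjacency i j • (List.ofFn fun t => ((MvPolynomial.pderiv (i, j t)).toLinearMap :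
            Module.End ℚ (EntryPoly n))).prod =
          (1 / ((k - 1).factorial : ℚ)) • iterDeriv ((e.erase i).val.map fun w => (i, w)) := by
        intro j hj
        have hj := (Finset.mem_filter.1 hj).2
        rw [KGraph.adjacency, hj, if_pos he, ← map_eq_of_insert_image_eq hek hi hj,
          Multiset.map_map]
        congr 1
        have : (Finset.univ.val.map ((fun w => (i, w)) ∘ j)) =
            ((List.ofFn fun t => (i, j t) : List _) : Multiset (Fin n × Fin n)) := by
          rw [Fin.univ_val_map]
          rfl
        rw [this, iterDeriv_coe_map, List.map_ofFn]
        rfl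
      rw [Finset.sum_congr rfl this, Finset.sum_const, card_enumerations hk hek hi, if_pos ⟨he, hi⟩,
        ← Nat.cast_smul_eq_nsmul ℚ, smul_smul, mul_one_div_cancel]
      positivity
    · rw [if_neg (fun h => hi h.2), zero_smul]
      refine Finset.sum_eq_zero fun j hj => ?_
      have hj := (Finset.mem_filter.1 hj).2
      exact absurd (hj ▸ Finset.mem_insert_self _ _) hi
  · rw [if_neg (fun h => he h.1), zero_smul]
    refine Finset.sum_eq_zero fun j hj => ?_
    have hj := (Finset.mem_filter.1 hj).2
    rw [KGraph.adjacency, hj, if_neg he, zero_smul]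

section Lists

/-- The number of times `v` takes the value `i`. -/
def fiberCount {d : ℕ} (v : Fin d → Fin n) (i : Fin n) : ℕ :=
  (Finset.univ.filter fun t => v t = i).card

/-- The weakly increasing list with `δ i` entries `i`. -/
def sortedList (δ : Fin n → ℕ) : List (Fin n) :=
  (List.ofFn fun i => List.replicate (δ i) i).flatten

theorem pairwise_sortedList (δ : Fin n → ℕ) : (sortedList δ).Pairwise (· ≤ ·) := by
  rw [sortedList, List.pairwise_flatten]
  constructor
  · intro l hl
    obtain ⟨i, rfl⟩ := (List.mem_ofFn' _ _).1 hl
    exact List.pairwise_replicate.2 (Or.inr le_rfl)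
  · rw [List.pairwise_ofFn]
    intro i j hij x hx y hy
    rw [List.eq_of_mem_replicate hx, List.eq_of_mem_replicate hy]
    exact hij.le

theorem count_sortedList (δ : Fin n → ℕ) (i : Fin n) : (sortedList δ).count i = δ i := by
  rw [sortedList, List.count_flatten, List.map_ofFn, List.sum_ofFn]
  simp [List.count_replicate]

theorem count_ofFn {d : ℕ} (v : Fin d → Fin n) (i : Fin n) :
    (List.ofFn v).count i = fiberCount v i := by
  rw [← Multiset.coe_count, ← Fin.univ_val_map, Multiset.count_map]
  simp only [@eq_comm _ i]
  rfl

theorem ofFn_eq_sortedList {d : ℕ} {v : Fin d → Fin n} (hv : Monotone v) :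
    List.ofFn v = sortedList (fiberCount v) := by
  refine List.Perm.eq_of_pairwise' hv.sortedLE_ofFn.pairwise (pairwise_sortedList _) ?_
  rw [List.perm_iff_count]
  intro i
  rw [count_ofFn, count_sortedList]

theorem prod_ofFn_pow_fiberCount {M : Type*} [Monoid M] {d : ℕ} {v : Fin d → Fin n}
    (hv : Monotone v) (F : Fin n → M) :
    (List.ofFn fun i => F i ^ fiberCount v i).prod = (List.ofFn fun t => F (v t)).prod := by
  have : (List.ofFn fun t => F (v t)) = (List.ofFn v).map F := by
    rw [List.map_ofFn]; rfl
  rw [this, ofFn_eq_sortedList hv, sortedList, List.map_flatten, List.prod_flatten, List.map_map,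
    List.map_ofFn]
  congr 2
  funext i
  simp

-- A composition of `d` is the list of fiber sizes of a unique monotone sequence; this is the source
-- of the ordering condition on rootings.
open scoped Classical in
theorem sum_piAntidiag_eq {M : Type*} [AddCommMonoid M] (d : ℕ) (G : (Fin n → ℕ) → M) :
    ∑ δ ∈ Finset.piAntidiag (Finset.univ : Finset (Fin n)) d, G δ =
      ∑ v : Fin d → Fin n with Monotone v, G (fiberCount v) := by
  symm
  refine Finset.sum_nbij fiberCount ?_ ?_ ?_ fun _ _ => rfl
  · intro v _
    rw [Finset.mem_piAntidiag]
    refine ⟨?_, by simp⟩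
    have := Finset.card_eq_sum_card_fiberwise (f := v) (s := Finset.univ) (t := Finset.univ)
      (by simp)
    rw [Finset.card_univ, Fintype.card_fin] at this
    exact this.symm
  · intro v hv w hw h
    have hv : Monotone v := by simpa using hv
    have hw : Monotone w := by simpa using hw
    exact List.ofFn_injective (by rw [ofFn_eq_sortedList hv, ofFn_eq_sortedList hw, h])
  · intro δ hδ
    have hδ := (Finset.mem_piAntidiag.1 hδ).1
    have hlen : (sortedList δ).length = d := by
      rw [sortedList, List.length_flatten, List.map_ofFn, List.sum_ofFn]
      simpa using hδ
    subst hlen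
    have hof : List.ofFn (sortedList δ).get = sortedList δ := List.ofFn_get _
    refine ⟨(sortedList δ).get, ?_, ?_⟩
    · have : Monotone (sortedList δ).get := by
        intro s t hst
        rcases hst.eq_or_lt with rfl | hst
        · exact le_rfl
        · exact List.pairwise_iff_get.1 (pairwise_sortedList δ) s t hst
      simpa using this
    · funext i
      rw [← count_ofFn, hof, count_sortedList]

theorem prod_ofFn_smul {A : Type*} [Monoid A] [MulAction ℚ A] [IsScalarTower ℚ A A]
    [SMulCommClass ℚ A A] {m : ℕ} (c : Fin m → ℚ) (M : Fin m → A) :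
    (List.ofFn fun i => c i • M i).prod = (∏ i, c i) • (List.ofFn M).prod := by
  induction m with
  | zero => simp
  | succ m ih =>
    rw [List.ofFn_succ, List.prod_cons, ih, Fin.prod_univ_succ, List.ofFn_succ, List.prod_cons,
      smul_mul_smul_comm]

theorem prod_ofFn_sum_iterDeriv {σ β : Type*} [Fintype β] {d : ℕ} (c : Fin d → β → ℚ)
    (s : Fin d → β → Multiset σ) :
    (List.ofFn fun t => ∑ e, c t e • iterDeriv (s t e)).prod =
      ∑ f : Fin d → β, (∏ t, c t (f t)) • iterDeriv (∑ t, s t (f t)) := by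
  induction d with
  | zero => simp
  | succ d ih =>
    rw [List.ofFn_succ, List.prod_cons, ih, Finset.sum_mul_sum,
      ← (Fin.consEquiv (fun _ => β)).sum_comp, Fintype.sum_prod_type]
    refine Finset.sum_congr rfl fun e _ => Finset.sum_congr rfl fun f _ => ?_
    rw [smul_mul_smul_comm, ← iterDeriv_add, Fin.prod_univ_succ, Fin.sum_univ_succ]
    rfl

end Lists

open scoped Classical in
theorem genTrace_eq {d : ℕ} (hk : 2 ≤ k) (hd : 1 ≤ d) (𝓗 : KGraph n k) :
    𝓗.adjacency.genTrace d = MvPolynomial.C (((k : ℚ) - 1) ^ (n - 1) *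
      ∑ R : StarSeq n d with (Monotone fun t => (R t).2) ∧
        ∀ t, (R t).1 ∈ 𝓗.edges ∧ (R t).2 ∈ (R t).1, R.weight k) := by
  rw [Hypermatrix.genTrace, sum_piAntidiag_eq, map_mul, ← MvPolynomial.smul_eq_C_mul, map_sum]
  congr 1
  rw [Finset.sum_filter, Finset.sum_filter,
    ← (Equiv.arrowProdEquivProdArrow (Fin d) (fun _ => Finset (Fin n))
      (fun _ => Fin n)).symm.sum_comp,
    Fintype.sum_prod_type_right]
  refine Finset.sum_congr rfl fun v _ => ?_
  by_cases hv : Monotone v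
  · rw [if_pos hv, prod_ofFn_smul, LinearMap.smul_apply, prod_ofFn_pow_fiberCount hv]
    simp only [KGraph.op_adjacency hk]
    rw [prod_ofFn_sum_iterDeriv (fun t e => if e ∈ 𝓗.edges ∧ v t ∈ e then (1 : ℚ) else 0)
      (fun t e => ((e.erase (v t)).val.map fun w => (v t, w))), LinearMap.sum_apply,
      Finset.smul_sum]
    refine Finset.sum_congr rfl fun f _ => ?_
    set R : StarSeq n d := (Equiv.arrowProdEquivProdArrow (Fin d) (fun _ => Finset (Fin n))
      (fun _ => Fin n)).symm (f, v) with hR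
    have hR1 : ∀ t, (R t).1 = f t := fun t => rfl
    have hR2 : ∀ t, (R t).2 = v t := fun t => rfl
    simp only [hR1, hR2]
    by_cases h : ∀ t, f t ∈ 𝓗.edges ∧ v t ∈ f t
    · have hu : R.IsUniform k := fun t => ⟨(h t).2, 𝓗.card_edge _ (h t).1⟩
      have harcs : R.arcs = ∑ t, ((f t).erase (v t)).val.map fun w => (v t, w) := rfl
      rw [if_pos ⟨hv, h⟩, Finset.prod_congr rfl fun t _ => if_pos (h t), Finset.prod_const_one,
        one_smul, ← harcs, StarSeq.weight, StarSeq.iterDeriv_arcs_eq_C hu hk hd,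
        MvPolynomial.constantCoeff_C, MvPolynomial.smul_eq_C_mul, ← map_mul, div_eq_inv_mul,
        Finset.prod_div_distrib, Finset.prod_const_one, one_div]
      rfl
    · rw [if_neg (fun h' => h h'.2)]
      push Not at h
      obtain ⟨t, ht⟩ := h
      rw [Finset.prod_eq_zero (Finset.mem_univ t), zero_smul, LinearMap.zero_apply, smul_zero]
      rw [if_neg]
      exact fun h' => ht h'.1 h'.2
  · rw [if_neg hv]
    symm
    refine Finset.sum_eq_zero fun f _ => ?_
    rw [if_neg]
    exact fun h => hv h.1

end TraceExpansion

/-! ### Invariance of weights under relabeling. -/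

namespace StarSeq

variable {n m k : ℕ}

theorem arcs_comp (R : StarSeq n m) (σ : Equiv.Perm (Fin m)) :
    StarSeq.arcs (R ∘ σ : Fin m → _) = R.arcs :=
  Equiv.sum_comp σ fun t => ((R t).1.erase (R t).2).val.map fun w => ((R t).2, w)

theorem rootCount_comp (R : StarSeq n m) (σ : Equiv.Perm (Fin m)) (v : Fin n) :
    StarSeq.rootCount (R ∘ σ : Fin m → _) v = R.rootCount v :=
  Finset.card_equiv σ fun t => by simp

theorem weight_comp (R : StarSeq n m) (σ : Equiv.Perm (Fin m)) :
    StarSeq.weight k (R ∘ σ : Fin m → _) = R.weight k := by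
  rw [weight, arcs_comp, weight]
  simp only [rootCount_comp]

/-- The image of `R` under a permutation of the vertices. -/
def relabel (π : Equiv.Perm (Fin n)) (R : StarSeq n m) : StarSeq n m :=
  fun t => ((R t).1.map π.toEmbedding, π (R t).2)

theorem arcs_relabel (π : Equiv.Perm (Fin n)) (R : StarSeq n m) :
    (R.relabel π).arcs = R.arcs.map (Equiv.prodCongr π π) := by
  rw [arcs, arcs, ← Multiset.coe_mapAddMonoidHom, map_sum]
  refine Finset.sum_congr rfl fun t _ => ?_
  have : ((R t).1.map π.toEmbedding).erase (π (R t).2) =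
      ((R t).1.erase (R t).2).map π.toEmbedding :=
    (Finset.map_erase π.toEmbedding _ _).symm
  rw [Multiset.coe_mapAddMonoidHom, Multiset.map_map, relabel, this, Finset.map_val,
    Multiset.map_map]
  rfl

theorem rootCount_relabel (π : Equiv.Perm (Fin n)) (R : StarSeq n m) (v : Fin n) :
    (R.relabel π).rootCount (π v) = R.rootCount v := by
  simp [rootCount, relabel]

/-- Permuting rows and columns simultaneously fixes the trace of a power. -/
theorem weight_relabel (π : Equiv.Perm (Fin n)) (R : StarSeq n m) :
    (R.relabel π).weight k = R.weight k := by
  rw [weight, weight, arcs_relabel, ← rename_trace_pow π, iterDeriv_map_rename,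
    rename_trace_pow, MvPolynomial.constantCoeff_rename,
    ← Equiv.prod_comp π fun v => (((R.relabel π).rootCount v * (k - 1)).factorial : ℚ)]
  simp only [rootCount_relabel]

/-- The image of `R` under a permutation of the vertices, sorted stably by roots. -/
def relabelSort (π : Equiv.Perm (Fin n)) (R : StarSeq n m) : StarSeq n m :=
  fun t => R.relabel π (Tuple.sort (fun t => π (R t).2) t)

theorem weight_relabelSort (π : Equiv.Perm (Fin n)) (R : StarSeq n m) :
    (R.relabelSort π).weight k = R.weight k :=
  (weight_comp _ _).trans (weight_relabel _ _)

theorem relabelSort_relabelSort {π ρ : Equiv.Perm (Fin n)} (h : ∀ v, ρ (π v) = v)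
    {R : StarSeq n m} (hR : Monotone fun t => (R t).2) :
    (R.relabelSort π).relabelSort ρ = R := by
  set s := Tuple.sort (fun t => π (R t).2) with hs
  have h1 : ∀ t, R.relabelSort π t = ((R (s t)).1.map π.toEmbedding, π (R (s t)).2) :=
    fun t => rfl
  -- Relabeling back restores the sorted roots of `R`, so `s.symm` sorts them; stability of `s`
  -- ensures that it also breaks ties as `Tuple.sort` does.
  have hsort : s.symm = Tuple.sort (fun t => ρ ((R.relabelSort π) t).2) := by
    rw [Tuple.eq_sort_iff]
    constructor
    · intro i j hij
      simpa [h1, h] using hR hij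
    · intro i j hij heq
      simp only [h1, h, Equiv.apply_symm_apply] at heq
      by_contra hlt
      have hne : s.symm j ≠ s.symm i := fun h' => hij.ne' (s.symm.injective h')
      have hlt' : s.symm j < s.symm i := lt_of_le_of_ne (not_lt.1 hlt) hne
      have := (Tuple.eq_sort_iff.1 hs).2 _ _ hlt' (by simp [heq])
      simp only [Equiv.apply_symm_apply] at this
      exact lt_asymm hij this
  funext t
  have h2 : (R.relabelSort π).relabelSort ρ t =
      (((R.relabelSort π) (s.symm t)).1.map ρ.toEmbedding, ρ ((R.relabelSort π) (s.symm t)).2) := by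
    rw [hsort]; rfl
  have h3 : ∀ e : Finset (Fin n), (e.map π.toEmbedding).map ρ.toEmbedding = e := by
    intro e
    rw [Finset.map_map]
    convert Finset.map_refl
    exact Function.Embedding.ext h
  rw [h2, h1, Equiv.apply_symm_apply, h, h3]

theorem IsRooting.relabelSort {π : Equiv.Perm (Fin n)} {R : StarSeq n m} {H G : MultiHypergraph n}
    (hR : R.IsRooting H) (hG : G.edges = H.edges.map (Finset.map π.toEmbedding)) :
    (R.relabelSort π).IsRooting G := by
  refine ⟨?_, fun t => ?_, Tuple.monotone_sort fun t => π (R t).2⟩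
  · rw [hG, ← hR.edges_eq, Multiset.map_map]
    conv_rhs => rw [← Multiset.map_univ_val_equiv (Tuple.sort fun t => π (R t).2),
      Multiset.map_map]
    rfl
  · exact Finset.mem_map_of_mem _ (hR.root_mem _)

end StarSeq

open scoped Classical in
/-- The total weight of the rootings of `H`. -/
def rootingSum {n : ℕ} (k m : ℕ) (H : MultiHypergraph n) : ℚ :=
  ∑ R : StarSeq n m with R.IsRooting H, R.weight k

theorem rootingSum_eq_of_perm {n k m : ℕ} {H G : MultiHypergraph n} (π : Equiv.Perm (Fin n))
    (hG : G.edges = H.edges.map (Finset.map π.toEmbedding)) :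
    rootingSum k m H = rootingSum k m G := by
  classical
  have hH : H.edges = G.edges.map (Finset.map π.symm.toEmbedding) := by
    rw [hG, Multiset.map_map]
    conv_lhs => rw [← Multiset.map_id H.edges]
    refine Multiset.map_congr rfl fun e _ => ?_
    rw [Function.comp_apply, Finset.map_map, id]
    convert (Finset.map_refl).symm
    exact Function.Embedding.ext π.symm_apply_apply
  refine Finset.sum_bij' (fun R _ => R.relabelSort π) (fun R _ => R.relabelSort π.symm)
    ?_ ?_ ?_ ?_ ?_
  · intro R hR
    simp only [Finset.mem_filter, Finset.mem_univ, true_and] at hR ⊢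
    exact hR.relabelSort hG
  · intro R hR
    simp only [Finset.mem_filter, Finset.mem_univ, true_and] at hR ⊢
    exact hR.relabelSort hH
  · intro R hR
    simp only [Finset.mem_filter, Finset.mem_univ, true_and] at hR
    exact StarSeq.relabelSort_relabelSort π.symm_apply_apply hR.mono
  · intro R hR
    simp only [Finset.mem_filter, Finset.mem_univ, true_and] at hR
    exact StarSeq.relabelSort_relabelSort π.apply_symm_apply hR.mono
  · intro R _
    exact (StarSeq.weight_relabelSort π R).symm

/-! ### Isomorphism invariance. -/

namespace MultiHypergraph

variable {n k : ℕ}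

theorem Connected.exists_mem_edge {H : MultiHypergraph n} (hH : H.Connected)
    {e₀ : Finset (Fin n)} (he₀ : e₀ ∈ H.edges) (hne : e₀.Nonempty) {v : Fin n}
    (hv : v ∈ H.verts) : ∃ e ∈ H.edges, v ∈ e := by
  obtain ⟨u, hu⟩ := hne
  rcases (hH.2 u (H.edge_subset _ he₀ hu) v hv).cases_tail with rfl | ⟨_, _, e, he, _, hve⟩
  · exact ⟨e₀, he₀, hu⟩
  · exact ⟨e, he, hve⟩

theorem isInfragraph_toMulti {H : MultiHypergraph n} {𝓗 : KGraph n k} :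
    H.IsInfragraph 𝓗.toMulti ↔ ∀ e ∈ H.edges, e ∈ 𝓗.edges := by
  constructor
  · intro h e he
    exact Multiset.mem_of_le h.2 (Multiset.mem_dedup.2 he)
  · intro h
    refine ⟨Finset.subset_univ _, ?_⟩
    rw [flatten, Multiset.le_iff_subset (Multiset.nodup_dedup _)]
    intro e he
    exact h e (Multiset.mem_dedup.1 he)

/-- An isomorphism extends to a permutation of the ambient vertex set. -/
theorem Iso.exists_perm {H G : MultiHypergraph n} (φ : Iso H G) :
    ∃ π : Equiv.Perm (Fin n), G.verts = H.verts.map π.toEmbedding ∧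
      G.edges = H.edges.map (Finset.map π.toEmbedding) := by
  obtain ⟨φ, hφ⟩ := φ
  have hπ : ∀ v (hv : v ∈ H.verts), φ.extendSubtype v = φ ⟨v, hv⟩ := fun v hv =>
    Equiv.extendSubtype_apply_of_mem φ v hv
  refine ⟨φ.extendSubtype, ?_, ?_⟩
  · ext w
    simp only [Finset.mem_map_equiv]
    constructor
    · intro hw
      have h : φ.extendSubtype (φ.symm ⟨w, hw⟩) = w := by
        rw [hπ _ (φ.symm ⟨w, hw⟩).2, Subtype.coe_eta, Equiv.apply_symm_apply]
      rw [← (Equiv.eq_symm_apply _).2 h]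
      exact (φ.symm ⟨w, hw⟩).2
    · intro hw
      have := hπ _ hw
      rw [Equiv.apply_symm_apply] at this
      rw [this]
      exact (φ _).2
  · rw [← hφ]
    refine Multiset.map_congr rfl fun e he => ?_
    have hsub := H.edge_subset e he
    ext w
    simp only [mapEdge, Finset.mem_image, Finset.mem_subtype, Finset.mem_map,
      Equiv.coe_toEmbedding]
    constructor
    · rintro ⟨v, hv, rfl⟩
      exact ⟨v, hv, hπ v v.2⟩
    · rintro ⟨v, hv, rfl⟩
      exact ⟨⟨v, hsub hv⟩, hv, (hπ v _).symm⟩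

theorem degree_map {H G : MultiHypergraph n} {π : Equiv.Perm (Fin n)}
    (hG : G.edges = H.edges.map (Finset.map π.toEmbedding)) (v : Fin n) :
    G.degree (π v) = H.degree v := by
  rw [degree, degree, hG, Multiset.filter_map, Multiset.card_map]
  congr 1
  refine Multiset.filter_congr fun e _ => ?_
  simp

theorem Iso.isVeblen {H G : MultiHypergraph n} (φ : Iso H G) (hH : H.IsVeblen k) :
    G.IsVeblen k := by
  obtain ⟨π, hv, he⟩ := φ.exists_perm
  constructor
  · intro e h
    rw [he] at h
    obtain ⟨e', he', rfl⟩ := Multiset.mem_map.1 h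
    rw [Finset.card_map, hH.1 e' he']
  · intro v h
    rw [hv] at h
    obtain ⟨w, hw, rfl⟩ := Finset.mem_map.1 h
    rw [Equiv.coe_toEmbedding, degree_map he]
    exact hH.2 w hw

theorem Iso.connected {H G : MultiHypergraph n} (φ : Iso H G) (hH : H.Connected) :
    G.Connected := by
  obtain ⟨π, hv, he⟩ := φ.exists_perm
  refine ⟨by rw [hv]; exact hH.1.map, ?_⟩
  rw [hv]
  intro u hu v hv
  obtain ⟨u, hu', rfl⟩ := Finset.mem_map.1 hu
  obtain ⟨v, hv', rfl⟩ := Finset.mem_map.1 hv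
  refine Relation.ReflTransGen.lift π.toEmbedding ?_ _ _ (hH.2 u hu' v hv')
  rintro a b ⟨e, h, ha, hb⟩
  refine ⟨e.map π.toEmbedding, ?_, Finset.mem_map_of_mem _ ha, Finset.mem_map_of_mem _ hb⟩
  rw [he]
  exact Multiset.mem_map_of_mem _ h

theorem Iso.card_edges {H G : MultiHypergraph n} (φ : Iso H G) :
    G.edges.card = H.edges.card := by
  rw [← φ.2, Multiset.card_map]

theorem Iso.rootingSum_eq {H G : MultiHypergraph n} (φ : Iso H G) (m : ℕ) :
    rootingSum k m H = rootingSum k m G := by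
  obtain ⟨π, -, he⟩ := φ.exists_perm
  exact rootingSum_eq_of_perm π he

end MultiHypergraph

/-! ### Rootings and the associated coefficient. -/

open MultiHypergraph

namespace StarSeq

variable {n m k : ℕ} {R : StarSeq n m} {H : MultiHypergraph n}

theorem IsRooting.edge_mem (hR : R.IsRooting H) (t : Fin m) : (R t).1 ∈ H.edges := by
  rw [← hR.edges_eq]
  exact Multiset.mem_map_of_mem _ (Finset.mem_univ t)

theorem IsRooting.exists_of_mem (hR : R.IsRooting H) {e : Finset (Fin n)} (he : e ∈ H.edges) :
    ∃ t, (R t).1 = e := by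
  rw [← hR.edges_eq] at he
  obtain ⟨t, -, ht⟩ := Multiset.mem_map.1 he
  exact ⟨t, ht⟩

theorem IsRooting.card_edges (hR : R.IsRooting H) : H.edges.card = m := by
  rw [← hR.edges_eq]
  simp

theorem IsRooting.isUniform (hR : R.IsRooting H) (hH : H.IsVeblen k) : R.IsUniform k :=
  fun t => ⟨hR.root_mem t, hH.1 _ (hR.edge_mem t)⟩

theorem mem_verts_digraph (hk : 2 ≤ k) (hR : R.IsUniform k) {t : Fin m} {v : Fin n}
    (hv : v ∈ (R t).1) : v ∈ R.digraph.verts := by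
  rw [MultiDigraph.verts, Finset.mem_union]
  by_cases h : v = (R t).2
  · left
    obtain ⟨w, hw, hne⟩ := Finset.exists_mem_ne (by rw [(hR t).2]; omega) (R t).2
    exact Finset.mem_image.2 ⟨⟨(t, w), hw, hne⟩, Finset.mem_univ _, h.symm⟩
  · right
    exact Finset.mem_image.2 ⟨⟨(t, v), hv, h⟩, Finset.mem_univ _, rfl⟩

theorem IsRooting.verts_subset (hk : 2 ≤ k) (hm : 1 ≤ m) (hR : R.IsRooting H) (hH : H.IsVeblen k)
    (hc : H.Connected) {r : Fin n} (hr : r ∈ H.verts) : r ∈ R.digraph.verts := by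
  have hu := hR.isUniform hH
  obtain ⟨e, he, hre⟩ := hc.exists_mem_edge (hR.edge_mem ⟨0, hm⟩) ⟨_, hR.root_mem _⟩ hr
  obtain ⟨t, rfl⟩ := hR.exists_of_mem he
  exact mem_verts_digraph hk hu hre

end StarSeq

/-- Rootings that are not Euler have weight zero, so they may be included freely; connectedness puts
`r` on an edge, hence in the digraph. -/
theorem assocCoeff_eq {n k : ℕ} (hk : 2 ≤ k) {H : MultiHypergraph n} (hH : H.IsVeblen k)
    (hc : H.Connected) (hm : 1 ≤ H.edges.card) {r : Fin n} (hr : r ∈ H.verts) :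
    (H.edges.card * (k - 1) : ℕ) * assocCoeff H r = rootingSum k H.edges.card H := by
  classical
  rw [assocCoeff, rootingSum, Finset.mul_sum, ← Finset.filter_filter, Finset.sum_filter]
  · refine Finset.sum_congr (by ext; simp) fun R hR => ?_
    have hR : R.IsRooting H := by simpa using hR
    have hu := hR.isUniform hH
    split_ifs with h
    · exact (StarSeq.weight_of_isEulerian hu h (hR.verts_subset hk hm hH hc hr)).symm
    · exact (StarSeq.weight_of_not_isEulerian hu hk hm h).symm

/-! ### Regrouping star sequences by their hypergraph. -/

namespace StarSeq

variable {n m k : ℕ} {R : StarSeq n m}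

/-- The multi-hypergraph formed by the edges of `R`. -/
def toHypergraph (R : StarSeq n m) : MultiHypergraph n where
  verts := Finset.univ.biUnion fun t => (R t).1
  edges := (Finset.univ : Finset (Fin m)).val.map fun t => (R t).1
  edge_subset := by
    intro e he
    obtain ⟨t, -, rfl⟩ := Multiset.mem_map.1 he
    exact Finset.subset_biUnion_of_mem (fun t => (R t).1) (Finset.mem_univ t)

theorem mem_edges_toHypergraph {e : Finset (Fin n)} :
    e ∈ R.toHypergraph.edges ↔ ∃ t, (R t).1 = e := by
  simp [toHypergraph]

theorem edge_mem_toHypergraph (t : Fin m) : (R t).1 ∈ R.toHypergraph.edges :=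
  mem_edges_toHypergraph.2 ⟨t, rfl⟩

theorem isVeblen_toHypergraph (hk : 2 ≤ k) (hR : R.IsUniform k) (h : R.digraph.IsEulerian) :
    R.toHypergraph.IsVeblen k := by
  constructor
  · intro e he
    obtain ⟨t, rfl⟩ := mem_edges_toHypergraph.1 he
    exact (hR t).2
  · intro v _
    have h1 : R.toHypergraph.degree v = (Finset.univ.filter fun t => v ∈ (R t).1).card := by
      rw [degree, toHypergraph, Multiset.filter_map, Multiset.card_map]
      rfl
    rw [h1, ← countP_arcs_snd hR, ← inDeg_digraph, inDeg_eq_rootCount_mul hR h]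
    refine ⟨R.rootCount v, ?_⟩
    obtain ⟨j, rfl⟩ : ∃ j, k = j + 1 := ⟨k - 1, by omega⟩
    rw [Nat.add_sub_cancel]
    ring

/-- The Euler tour links all sources, and every arc lies inside an edge. -/
theorem connected_toHypergraph (hk : 2 ≤ k) (hm : 1 ≤ m) (hR : R.IsUniform k)
    (h : R.digraph.IsEulerian) : R.toHypergraph.Connected := by
  refine ⟨⟨(R ⟨0, hm⟩).2, R.toHypergraph.edge_subset _ (edge_mem_toHypergraph ⟨0, hm⟩)
    (hR ⟨0, hm⟩).1⟩, ?_⟩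
  set r : Fin n → Fin n → Prop := fun a b => ∃ e ∈ R.toHypergraph.edges, a ∈ e ∧ b ∈ e with hr
  have hr_symm : Std.Symm r := ⟨by
    rintro a b ⟨e, he, ha, hb⟩
    exact ⟨e, he, hb, ha⟩⟩
  have hsymm : Std.Symm (Relation.ReflTransGen r) := Relation.ReflTransGen.stdSymm
  have harc : ∀ a : R.digraph.Arc, r (R.digraph.src a) (R.digraph.tgt a) := fun a =>
    ⟨(R a.1.1).1, edge_mem_toHypergraph _, (hR _).1, a.2.1⟩
  obtain ⟨T, hT⟩ := h
  have hN : 0 < Fintype.card R.digraph.Arc := by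
    rw [card_arc_digraph hR]
    exact Nat.mul_pos hm (by omega)
  have hstep : ∀ i (hi : i < Fintype.card R.digraph.Arc),
      Relation.ReflTransGen r (R.digraph.src (T ⟨0, hN⟩)) (R.digraph.src (T ⟨i, hi⟩)) := by
    intro i
    induction i with
    | zero => exact fun _ => .refl
    | succ i ih =>
      intro hi
      have hrot : finRotate _ (⟨i, by omega⟩ : Fin (Fintype.card R.digraph.Arc)) = ⟨i + 1, hi⟩ :=
        Fin.ext (by rw [val_finRotate]; exact Nat.mod_eq_of_lt hi)
      have := hT ⟨i, by omega⟩
      rw [hrot] at this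
      rw [← this]
      exact (ih (by omega)).tail (harc _)
  have hsrc : ∀ a, Relation.ReflTransGen r (R.digraph.src (T ⟨0, hN⟩)) (R.digraph.src a) := by
    intro a
    simpa using hstep (T.symm a) (T.symm a).2
  have hall : ∀ v ∈ R.toHypergraph.verts,
      Relation.ReflTransGen r (R.digraph.src (T ⟨0, hN⟩)) v := by
    intro v hv
    obtain ⟨t, -, ht⟩ := Finset.mem_biUnion.1 hv
    have := mem_verts_digraph hk hR ht
    rw [MultiDigraph.verts, Finset.mem_union, Finset.mem_image, Finset.mem_image] at this
    rcases this with ⟨a, -, rfl⟩ | ⟨a, -, rfl⟩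
    · exact hsrc a
    · exact (hsrc a).tail (harc a)
  intro u hu v hv
  exact (hsymm.symm _ _ (hall u hu)).trans (hall v hv)

/-- Connectedness together with an edge rules out isolated vertices, so the edges determine `H`. -/
theorem IsRooting.eq_toHypergraph (hm : 1 ≤ m) {H : MultiHypergraph n} (hR : R.IsRooting H)
    (hc : H.Connected) : H = R.toHypergraph := by
  refine MultiHypergraph.ext ?_ hR.edges_eq.symm
  ext v
  constructor
  · intro hv
    obtain ⟨e, he, hve⟩ := hc.exists_mem_edge (hR.edge_mem ⟨0, hm⟩) ⟨_, hR.root_mem _⟩ hv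
    obtain ⟨t, rfl⟩ := hR.exists_of_mem he
    exact Finset.mem_biUnion.2 ⟨t, Finset.mem_univ _, hve⟩
  · intro hv
    obtain ⟨t, -, ht⟩ := Finset.mem_biUnion.1 hv
    exact H.edge_subset _ (hR.edge_mem t) ht

end StarSeq

instance fintypeConnVeblenInfragraph {n k : ℕ} (𝓗 : KGraph n k) (d : ℕ) :
    Fintype (ConnVeblenInfragraph 𝓗 d) :=
  Fintype.ofFinite _

open scoped Classical in
theorem sum_weight_eq {n k d : ℕ} (hk : 2 ≤ k) (hd : 1 ≤ d) (𝓗 : KGraph n k) :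
    ∑ R : StarSeq n d with (Monotone fun t => (R t).2) ∧
        ∀ t, (R t).1 ∈ 𝓗.edges ∧ (R t).2 ∈ (R t).1, R.weight k =
      ∑ H : ConnVeblenInfragraph 𝓗 d, rootingSum k d H.1 := by
  simp only [rootingSum, Finset.sum_filter]
  rw [Finset.sum_comm]
  refine Finset.sum_congr rfl fun R _ => ?_
  split_ifs with h
  · obtain ⟨hmono, hR⟩ := h
    have hu : R.IsUniform k := fun t => ⟨(hR t).2, 𝓗.card_edge _ (hR t).1⟩
    by_cases hE : R.digraph.IsEulerian
    · have hroot : R.IsRooting R.toHypergraph := ⟨rfl, fun t => (hR t).2, hmono⟩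
      let H₀ : ConnVeblenInfragraph 𝓗 d := ⟨R.toHypergraph, by
        refine ⟨isInfragraph_toMulti.2 fun e he => ?_, R.isVeblen_toHypergraph hk hu hE,
          R.connected_toHypergraph hk hd hu hE, hroot.card_edges⟩
        obtain ⟨t, rfl⟩ := hroot.exists_of_mem he
        exact (hR t).1⟩
      rw [Finset.sum_eq_single H₀, if_pos hroot]
      · intro H _ hne
        rw [if_neg]
        exact fun hRH => hne (Subtype.ext (hRH.eq_toHypergraph hd H.2.2.2.1))
      · simp
    · rw [StarSeq.weight_of_not_isEulerian hu hk hd hE]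
      simp
  · symm
    refine Finset.sum_eq_zero fun H _ => ?_
    rw [if_neg]
    intro hRH
    refine h ⟨hRH.mono, fun t => ⟨?_, hRH.root_mem t⟩⟩
    exact isInfragraph_toMulti.1 H.2.1 _ (hRH.edge_mem t)

/-! ### Counting labeled copies. -/

namespace MultiHypergraph

variable {n k : ℕ}

/-- The image of `H` under an embedding of its vertex set. -/
def embed (H : MultiHypergraph n) (φ : H.verts ↪ Fin n) : MultiHypergraph n where
  verts := Finset.univ.map φ
  edges := H.edges.map fun e => (e.subtype (· ∈ H.verts)).map φ
  edge_subset := by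
    intro e he
    obtain ⟨e, -, rfl⟩ := Multiset.mem_map.1 he
    exact Finset.map_subset_map.2 (Finset.subset_univ _)

/-- The embedding of the vertex set given by an isomorphism. -/
def Iso.toEmbedding {H G : MultiHypergraph n} (φ : Iso H G) : H.verts ↪ Fin n :=
  φ.1.toEmbedding.trans (Function.Embedding.subtype _)

theorem Iso.embed_toEmbedding {H G : MultiHypergraph n} (φ : Iso H G) :
    H.embed φ.toEmbedding = G := by
  refine MultiHypergraph.ext ?_ ?_
  · ext w
    simp only [embed, Finset.mem_map, Finset.mem_univ, true_and]
    constructor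
    · rintro ⟨v, rfl⟩
      exact (φ.1 v).2
    · intro hw
      exact ⟨φ.1.symm ⟨w, hw⟩, congrArg Subtype.val (φ.1.apply_symm_apply ⟨w, hw⟩)⟩
  · rw [← φ.2]
    refine Multiset.map_congr rfl fun e _ => ?_
    rw [mapEdge, Finset.map_eq_image]
    rfl

/-- The isomorphism onto the image under an embedding. -/
def isoEmbed (H : MultiHypergraph n) (φ : H.verts ↪ Fin n) : Iso H (H.embed φ) :=
  ⟨Equiv.ofBijective (fun v => ⟨φ v, Finset.mem_map_of_mem _ (Finset.mem_univ v)⟩)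
    ⟨fun u v huv => φ.injective (congrArg Subtype.val huv), fun w => by
      obtain ⟨v, -, hv⟩ := Finset.mem_map.1 w.2
      exact ⟨v, Subtype.ext hv⟩⟩, by
    exact Multiset.map_congr rfl fun e _ => (Finset.map_eq_image φ _).symm⟩

theorem Iso.toEmbedding_injective {H G : MultiHypergraph n} :
    Function.Injective (Iso.toEmbedding : Iso H G → _) := by
  intro φ ψ h
  refine Subtype.ext (Equiv.ext fun v => Subtype.ext ?_)
  exact DFunLike.congr_fun h v

/-- The composition of isomorphisms. -/
def Iso.trans {H G K : MultiHypergraph n} (φ : Iso H G) (ψ : Iso G K) : Iso H K :=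
  ⟨φ.1.trans ψ.1, by
    obtain ⟨φ, hφ⟩ := φ
    obtain ⟨ψ, hψ⟩ := ψ
    dsimp only
    rw [← hψ, ← hφ, Multiset.map_map]
    exact Multiset.map_congr rfl fun e _ => (mapEdge_trans φ ψ e).symm⟩

/-- The inverse isomorphism. -/
def Iso.symm {H G : MultiHypergraph n} (φ : Iso H G) : Iso G H :=
  ⟨φ.1.symm, by
    obtain ⟨φ, hφ⟩ := φ
    dsimp only
    rw [← hφ, Multiset.map_map]
    conv_rhs => rw [← map_mapEdge_refl H]
    refine Multiset.map_congr rfl fun e _ => ?_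
    rw [Function.comp_apply, mapEdge_trans, Equiv.self_trans_symm]⟩

/-- Composing with a fixed isomorphism. -/
def Iso.autEquiv {H G : MultiHypergraph n} (φ : Iso H G) : Iso H G ≃ H.Aut where
  toFun ψ := ψ.trans φ.symm
  invFun ψ := ψ.trans φ
  left_inv _ := Subtype.ext (Equiv.ext fun _ => φ.1.apply_symm_apply _)
  right_inv _ := Subtype.ext (Equiv.ext fun _ => φ.1.symm_apply_apply _)

instance (H : MultiHypergraph n) : Finite H.Aut :=
  inferInstanceAs (Finite {φ : H.verts ≃ H.verts // H.edges.map (mapEdge φ) = H.edges})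

instance (H : MultiHypergraph n) : Nonempty H.Aut :=
  Iso.equivalence.refl H

/-- Copies of `H` with property `Q`, each counted `|Aut H|` times, are the embeddings of `H` whose
image has property `Q`. -/
theorem card_embeddings (H : MultiHypergraph n) (Q : MultiHypergraph n → Prop) :
    Nat.card {φ : H.verts ↪ Fin n // Q (H.embed φ)} =
      Nat.card {G : MultiHypergraph n // Q G ∧ Nonempty (Iso H G)} * Nat.card H.Aut := by
  rw [← Nat.card_prod]
  -- An embedding amounts to its image with an isomorphism onto it, and the isomorphisms onto a
  -- fixed copy are in bijection with `H.Aut`.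
  refine Nat.card_congr (Equiv.trans (Equiv.symm ?_)
    ((Equiv.sigmaCongrRight fun G => (Classical.choice G.2.2).autEquiv).trans
      (Equiv.sigmaEquivProd {G : MultiHypergraph n // Q G ∧ Nonempty (Iso H G)} H.Aut)))
  refine Equiv.ofBijective
    (fun x => ⟨x.2.toEmbedding, by rw [x.2.embed_toEmbedding]; exact x.1.2.1⟩) ⟨?_, fun φ =>
      ⟨⟨⟨H.embed φ.1, φ.2, ⟨H.isoEmbed φ.1⟩⟩, H.isoEmbed φ.1⟩, rfl⟩⟩
  rintro ⟨⟨G, hG⟩, φ⟩ ⟨⟨G', hG'⟩, ψ⟩ h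
  have h : φ.toEmbedding = ψ.toEmbedding := congrArg Subtype.val h
  have hGG : G = G' :=
    φ.embed_toEmbedding.symm.trans ((congrArg H.embed h).trans ψ.embed_toEmbedding)
  subst hGG
  rw [Iso.toEmbedding_injective h]

theorem flatten_embed (H : MultiHypergraph n) (φ : H.verts ↪ Fin n) :
    (H.embed φ).flatten = H.flatten.embed φ := by
  refine MultiHypergraph.ext rfl ?_
  change (H.edges.map fun e => (e.subtype (· ∈ H.verts)).map φ).dedup =
    H.edges.dedup.map fun e => (e.subtype (· ∈ H.verts)).map φ
  rw [Multiset.Nodup.ext (Multiset.nodup_dedup _)]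
  · intro e
    simp
  · refine Multiset.Nodup.map_on (fun e he e' he' h => ?_) (Multiset.nodup_dedup _)
    have h := Finset.map_injective φ h
    have hsub := H.edge_subset e (Multiset.mem_dedup.1 he)
    have hsub' := H.edge_subset e' (Multiset.mem_dedup.1 he')
    ext v
    constructor
    · intro hv
      have : (⟨v, hsub hv⟩ : H.verts) ∈ e.subtype (· ∈ H.verts) := Finset.mem_subtype.2 hv
      rw [h] at this
      exact Finset.mem_subtype.1 this
    · intro hv
      have : (⟨v, hsub' hv⟩ : H.verts) ∈ e'.subtype (· ∈ H.verts) := Finset.mem_subtype.2 hv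
      rw [← h] at this
      exact Finset.mem_subtype.1 this

/-- `H` and its flattening have the same embeddings into `G`. Counting these once through each
automorphism group gives the quotient in `count`. -/
theorem count_eq (H G : MultiHypergraph n) :
    H.count G = Nat.card {H' : MultiHypergraph n // H'.IsInfragraph G ∧ Nonempty (Iso H H')} := by
  have h1 := card_embeddings H fun H' => H'.IsInfragraph G
  have h2 := card_embeddings H.flatten fun S => S.IsSub G
  have h3 : Nat.card {φ : H.verts ↪ Fin n // (H.embed φ).IsInfragraph G} =
      Nat.card {φ : H.flatten.verts ↪ Fin n // (H.flatten.embed φ).IsSub G} := by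
    refine Nat.card_congr (Equiv.subtypeEquivRight fun φ => ?_)
    rw [IsInfragraph, flatten_embed]
  have h4 : Nat.card {S : MultiHypergraph n // S.IsSub G ∧ Nonempty (Iso S H.flatten)} =
      Nat.card {S : MultiHypergraph n // S.IsSub G ∧ Nonempty (Iso H.flatten S)} :=
    Nat.card_congr (Equiv.subtypeEquivRight fun S =>
      and_congr_right fun _ => ⟨Iso.equivalence.symm, Iso.equivalence.symm⟩)
  have h5 : (Nat.card H.Aut : ℚ) ≠ 0 := by
    exact_mod_cast Nat.card_pos.ne'
  rw [h3, h2] at h1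
  rw [count, h4, div_mul_eq_mul_div, div_eq_iff h5, mul_comm]
  exact_mod_cast h1

end MultiHypergraph

open scoped Classical in
theorem sum_rootingSum_eq {n k d : ℕ} (𝓗 : KGraph n k)
    (rep : VeblenClasses 𝓗 d → ConnVeblenInfragraph 𝓗 d)
    (hrep : ∀ c, Quotient.mk (isoSetoid 𝓗 d) (rep c) = c) :
    ∑ H : ConnVeblenInfragraph 𝓗 d, rootingSum k d H.1 =
      ∑ c, rootingSum k d (rep c).1 * (rep c).1.count 𝓗.toMulti := by
  let cls : ConnVeblenInfragraph 𝓗 d → VeblenClasses 𝓗 d := Quotient.mk (isoSetoid 𝓗 d)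
  rw [← Finset.sum_fiberwise (s := Finset.univ) (g := cls)]
  refine Finset.sum_congr rfl fun c _ => ?_
  have hiso : ∀ H : ConnVeblenInfragraph 𝓗 d, Quotient.mk (isoSetoid 𝓗 d) H = c ↔
      Nonempty (Iso (rep c).1 H.1) := by
    intro H
    conv_lhs => rw [← hrep c]
    rw [eq_comm]
    exact Quotient.eq
  have hcard : (Finset.univ.filter fun H : ConnVeblenInfragraph 𝓗 d =>
      cls H = c).card =
      Nat.card {H' : MultiHypergraph n //
        H'.IsInfragraph 𝓗.toMulti ∧ Nonempty (Iso (rep c).1 H')} := by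
    rw [← Fintype.card_subtype, ← Nat.card_eq_fintype_card]
    refine Nat.card_congr
      { toFun := fun H => ⟨H.1.1, H.1.2.1, (hiso H.1).1 H.2⟩
        invFun := fun H => ⟨⟨H.1, H.2.1, ?_⟩, ?_⟩
        left_inv := fun H => rfl
        right_inv := fun H => rfl }
    · obtain ⟨φ⟩ := H.2.2
      exact ⟨φ.isVeblen (rep c).2.2.1, φ.connected (rep c).2.2.2.1,
        φ.card_edges.trans (rep c).2.2.2.2⟩
    · exact (hiso _).2 H.2.2
  rw [count_eq, ← hcard, mul_comm, ← nsmul_eq_mul, ← Finset.sum_const]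
  refine Finset.sum_congr rfl fun H hH => ?_
  obtain ⟨φ⟩ := (hiso H).1 (Finset.mem_filter.1 hH).2
  exact (φ.rootingSum_eq d).symm

end VeblenTrace

end

/-- The formula holds for every choice of a representative `rep c` of each isomorphism class `c` and
of a specified root `root c`, a vertex of `rep c`, at which arborescences are counted. -/
theorem lemma4p4 (n k d : ℕ) (hk : 2 ≤ k) (hd : 1 ≤ d) (𝓗 : VeblenTrace.KGraph n k)
    (rep : VeblenTrace.VeblenClasses 𝓗 d → VeblenTrace.ConnVeblenInfragraph 𝓗 d)
    (hrep : ∀ c, Quotient.mk (VeblenTrace.isoSetoid 𝓗 d) (rep c) = c)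
    (root : VeblenTrace.VeblenClasses 𝓗 d → Fin n)
    (hroot : ∀ c, root c ∈ (rep c).1.verts) :
    𝓗.adjacency.genTrace d =
      MvPolynomial.C ((d : ℚ) * ((k : ℚ) - 1) ^ n *
        ∑ c : VeblenTrace.VeblenClasses 𝓗 d,
          VeblenTrace.assocCoeff (rep c).1 (root c) * (rep c).1.count 𝓗.toMulti) := by
  rw [VeblenTrace.genTrace_eq hk hd, VeblenTrace.sum_weight_eq hk hd,
    VeblenTrace.sum_rootingSum_eq 𝓗 rep hrep, Finset.mul_sum, Finset.mul_sum]
  congr 1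
  refine Finset.sum_congr rfl fun c _ => ?_
  obtain ⟨-, hV, hC, hcard⟩ := (rep c).2
  have hcoeff := VeblenTrace.assocCoeff_eq hk hV hC (hcard.symm ▸ hd) (hroot c)
  rw [hcard] at hcoeff
  -- The exponent `n - 1` truncates only for `n = 0`, where there is no root and hence no class to
  -- sum over.
  obtain ⟨j, rfl⟩ : ∃ j, n = j + 1 := ⟨n - 1, by have := (root c).pos; omega⟩
  rw [← hcoeff, Nat.add_sub_cancel, pow_succ]
  push_cast [Nat.cast_sub (show 1 ≤ k by omega)]
  ring
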